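/- **Setting.** There are $K+1$ mobile network operators (MNOs) $0,1,\dots,K$; MNO $0$ is the buyer and shares the infrastructure of a set $\mathcal N\subseteq\{1,\dots,K\}$ of sellers. The base stations (BSs) of MNO $k$ form a homogeneous Poisson point process in $\mathbb R^2$ with intensity $\lambda_k\ge 0$, independently for different $k$, and $\lambda:=\lambda_0+\sum_{k\in\mathcal N}\lambda_k>0$. The typical user of MNO $0$ is at the origin and associates with the nearest BS (BS-$0$, at distance $r_0$) of the enlarged set $\mathcal F$ of BSs of all MNOs $k\in\mathcal N\cup\{0\}$. All BSs transmit with power $p>0$, the path-loss exponent is $\alpha>2$, the noise variance is $\sigma^2\ge 0$, the SINR threshold is $T>0$. Let $$\mathrm{SINR}=\frac{g_0r_0^{-\alpha}p}{I+\sigma^2},\qquad I=\sum_{i\in\mathcal F\setminus\{0\}}\xi_i g_i r_i^{-\alpha}p,\qquad P_c=\Pr(\mathrm{SINR}>T),$$ where $pg_0$ is exponentially distributed with rate $1/p$ (Rayleigh fading of the message signal, with mean received power $p$ at unit distance), the $pg_i$ are i.i.d. copies of an almost surely positive random variable $g$, and the activity indicators $\xi_i\in\{0,1\}$ satisfy $\Pr(\xi_i=1)=w_k$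 if BS-$i$ belongs to MNO $k$, with activity levels $w_k\ge 0$, $\sum_{k\in\mathcal N\cup\{0\}}w_k=1$; all the gains and indicators are independent of each other and of the BS locations. Thus the potential interferers have intensity $\bar\lambda=\sum_{k\in\mathcal N\cup\{0\}}w_k\lambda_k$, while the intensity for association is $\lambda$. Put $$\beta=\frac{2(T/p)^{2/\alpha}}{\alpha}\,\mathbb E\Big[g^{2/\alpha}\big(\Gamma(-\tfrac2\alpha,\tfrac{Tg}{p})-\Gamma(-\tfrac2\alpha)\big)\Big],\qquad B=\frac{T\sigma^2}{p},\qquad A_2=\pi\big(\bar\lambda(\beta-1)+\lambda\big),$$ where $\Gamma(a,x)=\int_x^\infty t^{a-1}e^{-t}\,dt$ and the expectation in $\beta$ is assumed finite. **Proposition.** (a) For every such choice of activity levels $w_k$, $$P_c=\pi\lambda\int_0^\infty\exp\{-(A_2z+Bz^{\alpha/2})\}\,dz,$$ where the integral converges. (b) The approximation $P_c\simeq\pi\lambda_A\Big[A+\frac{\alpha}{2}\frac{B^{2/\alpha}}{\Gamma(2/\alpha)}\Big]^{-1}$ with $\lambda_A=\lambda$, $A=A_2$ takes the form $$P_c\simeq\Big[1+\frac{\bar\lambda(\beta-1)}{\lambda}+\frac{\alpha}{2\pi\lambda}\frac{B^{2/\alpha}}{\Gamma(2/\alpha)}\Big]^{-1},$$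 and the ratio of $P_c$ to this expression tends to $1$ both as $\sigma^2\to0^+$ (interference-limited regime) and as $\sigma^2\to\infty$ (noise-limited regime), all other parameters being fixed. (c) For $k\in\mathcal N\cup\{0\}$, the probability that the typical user associates with a BS of MNO $k$ is $\lambda_k/\lambda$; so, when the activity level $w_k$ is this association probability, $w_k=\lambda_k/\lambda$, and (a), (b) hold with $\bar\lambda=\sum_{k\in\mathcal N\cup\{0\}}\lambda_k^2/\lambda$. -/

import Mathlib

open MeasureTheory ProbabilityTheory Filter Topology Set
open scoped ENNReal NNReal

/-- The plane in which base stations (BSs) and users are located. -/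
abbrev Plane : Type := EuclideanSpace ℝ (Fin 2)

/-- `pointCount num X A ω` is the number of points of the point collection
`X 0 ω, X 1 ω, …` (only the first `num ω` of which exist) that lie in `A`. -/
noncomputable def pointCount {Ω : Type*} (num : Ω → ℕ∞) (X : ℕ → Ω → Plane) (A : Set Plane)
    (ω : Ω) : ℕ∞ :=
  Set.encard {n : ℕ | (n : ℕ∞) < num ω ∧ X n ω ∈ A}

/-- The point collection `X n`, `n < num`, is a homogeneous Poisson point process on the plane
with intensity `lam` points per unit area. -/
structure IsHomogeneousPPP {Ω : Type*} [MeasurableSpace Ω] (μ : Measure Ω)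
    (num : Ω → ℕ∞) (X : ℕ → Ω → Plane) (lam : ℝ) : Prop where
  measurable_num : Measurable num
  measurable_point : ∀ n, Measurable (X n)
  /-- the number of points in a set of finite area is Poisson with mean `lam` times the area -/
  count_law : ∀ A : Set Plane, MeasurableSet A → volume A ≠ ∞ →
    HasLaw (pointCount num X A)
      ((poissonMeasure (lam * (volume A).toReal).toNNReal).map (Nat.cast : ℕ → ℕ∞)) μ
  /-- the numbers of points in disjoint sets are independent -/
  count_indep : ∀ (m : ℕ) (A : Fin m → Set Plane), (∀ j, MeasurableSet (A j)) →
    Pairwise (fun i j => Disjoint (A i) (A j)) →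
    iIndepFun (fun j => pointCount num X (A j)) μ

/-- The random quantities of a system of `K + 1` mobile network operators (MNOs), as seen by the
typical user at the origin.  BS number `n` of MNO `k` is the pair `(k, n)`; it exists when
`n < num k ω`.  MNO `0` is the buyer. -/
structure CellularNetwork (K : ℕ) (Ω : Type*) where
  /-- number of BSs of an MNO -/
  num : Fin (K + 1) → Ω → ℕ∞
  /-- location of a BS -/
  loc : Fin (K + 1) → ℕ → Ω → Plane
  /-- channel power gain from a BS to the typical user, when that BS interferes -/
  gain : Fin (K + 1) × ℕ → Ω → ℝ
  /-- whether a BS is active in the spectrum of the buyer -/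
  active : Fin (K + 1) × ℕ → Ω → Bool
  /-- channel power gain of the message signal -/
  signalGain : Ω → ℝ

namespace CellularNetwork

variable {K : ℕ} {Ω : Type*}

/-- Location of the BS `i`. -/
def pos (N : CellularNetwork K Ω) (i : Fin (K + 1) × ℕ) (ω : Ω) : Plane := N.loc i.1 i.2 ω

/-- The enlarged set of BSs a user of the buyer can associate with: all the BSs of the buyer and of
the sellers in `S`. -/
def sharedBS (N : CellularNetwork K Ω) (S : Finset (Fin (K + 1))) (ω : Ω) :
    Set (Fin (K + 1) × ℕ) :=
  {i | i.1 ∈ insert 0 S ∧ (i.2 : ℕ∞) < N.num i.1 ω}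

/-- The BS `i` serves the typical user: it is a nearest one among the enlarged set of BSs. -/
def IsServing (N : CellularNetwork K Ω) (S : Finset (Fin (K + 1))) (ω : Ω)
    (i : Fin (K + 1) × ℕ) : Prop :=
  i ∈ N.sharedBS S ω ∧ ∀ j ∈ N.sharedBS S ω, ‖N.pos i ω‖ ≤ ‖N.pos j ω‖

/-- The distance from the typical user to the serving BS. -/
noncomputable def servingDist (N : CellularNetwork K Ω) (S : Finset (Fin (K + 1))) (ω : Ω) : ℝ :=
  sInf ((fun i => ‖N.pos i ω‖) '' N.sharedBS S ω)

/-- The interference: the total power received from the active BSs other than the serving one,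
all transmitting with power `p`, with path-loss exponent `α`. -/
noncomputable def interference (N : CellularNetwork K Ω) (S : Finset (Fin (K + 1)))
    (p α : ℝ) (ω : Ω) : ℝ≥0∞ :=
  ∑' i : {i : Fin (K + 1) × ℕ // i ∈ N.sharedBS S ω ∧ ¬ N.IsServing S ω i},
    ENNReal.ofReal (((N.active i ω).toNat : ℝ) * N.gain i ω * ‖N.pos i ω‖ ^ (-α) * p)

/-- The downlink SINR of the typical user, for noise variance `s`. -/
noncomputable def sinr (N : CellularNetwork K Ω) (S : Finset (Fin (K + 1)))
    (p α s : ℝ) (ω : Ω) : ℝ≥0∞ :=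
  ENNReal.ofReal (N.signalGain ω * N.servingDist S ω ^ (-α) * p) /
    (N.interference S p α ω + ENNReal.ofReal s)

/-- The coverage probability: the probability that the SINR exceeds the threshold `T`. -/
noncomputable def coverageProb [MeasurableSpace Ω] (N : CellularNetwork K Ω) (μ : Measure Ω)
    (S : Finset (Fin (K + 1))) (p α s T : ℝ) : ℝ :=
  μ.real {ω | ENNReal.ofReal T < N.sinr S p α s ω}

/-- The probability that the typical user associates with a BS of MNO `k`. -/
noncomputable def associationProb [MeasurableSpace Ω] (N : CellularNetwork K Ω) (μ : Measure Ω)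
    (S : Finset (Fin (K + 1))) (k : Fin (K + 1)) : ℝ :=
  μ.real {ω | ∃ n : ℕ, N.IsServing S ω (k, n)}

/-- The probabilistic assumptions: MNO `k` has a homogeneous PPP of BSs with intensity `lam k`; the
BSs of MNO `k` are independently active with probability `w k`; the message signal undergoes
Rayleigh fading with mean received power (at unit distance) equal to the transmit power `p`; the
powers `p * gain` of the interfering links (at unit distance) have the common law `ν`. -/
structure IsModel [MeasurableSpace Ω] (N : CellularNetwork K Ω) (μ : Measure Ω)
    (S : Finset (Fin (K + 1))) (lam w : Fin (K + 1) → ℝ) (p : ℝ) (ν : Measure ℝ) : Prop where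
  ppp : ∀ k, IsHomogeneousPPP μ (N.num k) (N.loc k) (lam k)
  measurable_gain : ∀ i, Measurable (N.gain i)
  measurable_active : ∀ i, Measurable (N.active i)
  measurable_signalGain : Measurable N.signalGain
  gain_law : ∀ i, HasLaw (fun ω => p * N.gain i ω) ν μ
  active_law : ∀ i : Fin (K + 1) × ℕ, i.1 ∈ insert 0 S →
    μ {ω | N.active i ω = true} = ENNReal.ofReal (w i.1)
  signal_law : HasLaw (fun ω => p * N.signalGain ω) (expMeasure (1 / p)) μ
  /-- different MNOs have independent point processes -/
  indep_ppp : iIndepFun (fun k ω => (N.num k ω, fun n => N.loc k n ω)) μ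
  /-- the gain and the activity of one BS are independent -/
  indep_gain_active : ∀ i, IndepFun (N.gain i) (N.active i) μ
  /-- the marks (gain, activity) of different BSs are independent -/
  indep_marks : iIndepFun (fun i ω => (N.gain i ω, N.active i ω)) μ
  /-- the marks are independent of the locations -/
  indep_loc_marks : IndepFun
    (fun ω => fun k : Fin (K + 1) => (N.num k ω, fun n => N.loc k n ω))
    (fun ω => fun i => (N.gain i ω, N.active i ω)) μ
  /-- the gain of the message signal is independent of everything else -/
  indep_signal : IndepFun
    (fun ω => ((fun k : Fin (K + 1) => (N.num k ω, fun n => N.loc k n ω)),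
      fun i => (N.gain i ω, N.active i ω)))
    N.signalGain μ

end CellularNetwork

/-- The upper incomplete Gamma function `Γ(a, x) = ∫_x^∞ t^(a-1) e^(-t) dt`. -/
noncomputable def upperGamma (a x : ℝ) : ℝ :=
  ∫ t in Ioi x, t ^ (a - 1) * Real.exp (-t)

/-- The random variable `g^(2/α) (Γ(-2/α, T g / p) - Γ(-2/α))`, as a function of `g`, whose
expectation enters `β`. -/
noncomputable def betaTerm (T p α : ℝ) (g : ℝ) : ℝ :=
  g ^ (2 / α) * (upperGamma (-(2 / α)) (T * g / p) - Real.Gamma (-(2 / α)))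

/-- The constant `β = (2 (T/p)^(2/α) / α) E[g^(2/α) (Γ(-2/α, T g / p) - Γ(-2/α))]`, where `g` has
the law `ν`. -/
noncomputable def betaConst (T p α : ℝ) (ν : Measure ℝ) : ℝ :=
  2 * (T / p) ^ (2 / α) / α * ∫ g, betaTerm T p α g ∂ν

/-- The net intensity of the BSs a user of the buyer can associate with. -/
noncomputable def netIntensity {K : ℕ} (S : Finset (Fin (K + 1))) (lam : Fin (K + 1) → ℝ) : ℝ :=
  lam 0 + ∑ k ∈ S, lam k

/-- The intensity of the interfering BSs, for activity levels `w`. -/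
noncomputable def interfererIntensity {K : ℕ} (S : Finset (Fin (K + 1)))
    (w lam : Fin (K + 1) → ℝ) : ℝ :=
  ∑ k ∈ insert 0 S, w k * lam k

/-- The closed form by which `π lamA ∫_0^∞ exp(-(A z + B z^(α/2))) dz` is approximated. -/
noncomputable def approxCoverage (lamA A B α : ℝ) : ℝ :=
  Real.pi * lamA * (A + α / 2 * (B ^ (2 / α) / Real.Gamma (2 / α)))⁻¹

/-! Write r for the distance to the serving BS. Given everything but the message signal, Rayleigh
fading turns the coverage probability into exp(-T r^α (I + σ²)/p). Averaging over the independent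
gains and activities replaces each BS of MNO k at a point x beyond r by the factor 1 - w_k L_r(x),
where L_r is `interferenceLoss`. The product of these factors is again of the form exp(-sum over
points), with weight -log(1 - w_k L_r(x)), so it falls under the Laplace functional of a Poisson
process: the exponent is λ_k ∫ w_k L_r over ‖x‖ > r, which equals w_k λ_k π r² (β - 1). As r² is
exponential with rate πλ, integrating over z = r² gives (a).

The delicate point is that, given r, the BSs beyond r are still Poisson. No conditional laws are
used. Weight ∞ on a disk makes exp(-sum) the indicator that the disk is empty, so the Laplace
functional also covers expectations on {D ≥ a}, with D the distance to the nearest point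
(`setLIntegral_expNeg_of_le_nearestDist`). Differences give shells {a ≤ D < b} for weights supported
beyond b (`setLIntegral_expNeg_shell`). Letting dyadic shells shrink gives
`lintegral_expNeg_beyond_nearestDist`.

The closed form of β is a radial integral: with u = ‖x‖²/r² area becomes Lebesgue measure up to the
factor π r², and 1 - exp(-c u^(-α/2)) has an antiderivative in terms of the incomplete Gamma
function (`integral_one_sub_exp_neg_rpow`).

For (b), dominated convergence gives the limit of the integral as B → 0 and, after rescaling z by
B^(-2/α), its leading order as B → ∞; the approximation has the same leading terms. For (c), the
squared distances to the nearest BS of MNO k and of the other MNOs are independent exponentials, and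
the probability that the first is smaller is λ_k/λ. -/

/-! ### Exponential and logarithm with values in [0, ∞] -/

/-- The function `x ↦ e⁻ˣ` on `[0, ∞]`. -/
noncomputable def expNeg (x : ℝ≥0∞) : ℝ≥0∞ := (EReal.exp (x : EReal))⁻¹

@[simp] lemma expNeg_zero : expNeg 0 = 1 := by simp [expNeg]

@[simp] lemma expNeg_top : expNeg ∞ = 0 := by simp [expNeg]

lemma expNeg_ofReal {x : ℝ} (hx : 0 ≤ x) :
    expNeg (ENNReal.ofReal x) = ENNReal.ofReal (Real.exp (-x)) := by
  rw [expNeg, EReal.coe_ennreal_ofReal, max_eq_left hx, EReal.exp_coe,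
    ← ENNReal.ofReal_inv_of_pos (Real.exp_pos _), Real.exp_neg]

lemma expNeg_antitone : Antitone expNeg := fun x y h => by
  rw [expNeg, expNeg, ENNReal.inv_le_inv]
  exact EReal.exp_monotone (by exact_mod_cast h)

lemma expNeg_le_one (x : ℝ≥0∞) : expNeg x ≤ 1 := by
  simpa using expNeg_antitone (zero_le (a := x))

lemma expNeg_ne_top (x : ℝ≥0∞) : expNeg x ≠ ∞ := ne_top_of_le_ne_top ENNReal.one_ne_top
  (expNeg_le_one x)

lemma continuous_expNeg : Continuous expNeg := by
  unfold expNeg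
  exact continuous_inv.comp (ENNReal.continuous_exp.comp continuous_coe_ennreal_ereal)

@[fun_prop] lemma measurable_expNeg : Measurable expNeg := continuous_expNeg.measurable

lemma expNeg_add (x y : ℝ≥0∞) : expNeg (x + y) = expNeg x * expNeg y := by
  rw [expNeg, EReal.coe_ennreal_add, EReal.exp_add, ENNReal.mul_inv]
  · rfl
  · left; simp
  · right
    rw [Ne, EReal.exp_eq_zero_iff]
    exact EReal.coe_ennreal_ne_bot y

lemma expNeg_finset_sum {ι : Type*} (s : Finset ι) (f : ι → ℝ≥0∞) :
    expNeg (∑ i ∈ s, f i) = ∏ i ∈ s, expNeg (f i) := by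
  classical
  induction s using Finset.induction_on with
  | empty => simp
  | insert a s ha ih => rw [Finset.sum_insert ha, Finset.prod_insert ha, expNeg_add, ih]

lemma expNeg_mul_natCast (c : ℝ≥0∞) (n : ℕ) : expNeg (c * n) = expNeg c ^ n := by
  induction n with
  | zero => simp
  | succ n ih => rw [pow_succ, ← ih, ← expNeg_add]; push_cast; rw [mul_add, mul_one]

/-- The function `q ↦ -log q` on `[0, 1]`, continued by `0`. -/
noncomputable def negLog (q : ℝ≥0∞) : ℝ≥0∞ := (-(ENNReal.log q)).toENNReal

lemma continuous_negLog : Continuous negLog :=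
  (ENNReal.continuous_log.neg).ereal_toENNReal

@[fun_prop] lemma measurable_negLog : Measurable negLog := continuous_negLog.measurable

lemma negLog_antitone : Antitone negLog := fun _ _ h =>
  EReal.toENNReal_le_toENNReal (EReal.neg_le_neg_iff.2 (ENNReal.log_monotone h))

lemma expNeg_negLog {q : ℝ≥0∞} (hq : q ≤ 1) : expNeg (negLog q) = q := by
  rw [expNeg, negLog, EReal.coe_toENNReal, EReal.exp_neg, inv_inv, ENNReal.exp_log]
  rw [EReal.neg_nonneg]
  simpa using ENNReal.log_monotone hq

/-! ### Expectations under independence -/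

section Independence

variable {Ω : Type*} [MeasurableSpace Ω] {μ : Measure Ω}

lemma lintegral_finset_prod_of_iIndepFun {ι : Type*} {f : ι → Ω → ℝ≥0∞} (hf : iIndepFun f μ)
    [IsProbabilityMeasure μ] (hm : ∀ i, Measurable (f i)) (s : Finset ι) :
    ∫⁻ ω, ∏ i ∈ s, f i ω ∂μ = ∏ i ∈ s, ∫⁻ ω, f i ω ∂μ := by
  classical
  induction s using Finset.induction_on with
  | empty => simp
  | insert a s ha ih =>
    simp_rw [Finset.prod_insert ha, mul_comm (f a _)]
    rw [mul_comm (∫⁻ ω, f a ω ∂μ), ← ih]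
    have h := lintegral_mul_eq_lintegral_mul_lintegral_of_indepFun
      (f := ∏ i ∈ s, f i) (by simpa only [Finset.prod_fn] using s.measurable_prod fun i _ => hm i) (hm a)
      (hf.indepFun_finsetProd_of_notMem hm ha)
    simpa only [Pi.mul_apply, Finset.prod_apply] using h

/-- The Laplace transform of a countable sum of independent random variables. -/
lemma lintegral_expNeg_tsum_of_iIndepFun {ι : Type*} [Countable ι] {f : ι → Ω → ℝ≥0∞}
    [IsProbabilityMeasure μ] (hf : iIndepFun f μ) (hm : ∀ i, Measurable (f i)) :
    ∫⁻ ω, expNeg (∑' i, f i ω) ∂μ = expNeg (∑' i, negLog (∫⁻ ω, expNeg (f i ω) ∂μ)) := by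
  have hq : ∀ i, ∫⁻ ω, expNeg (f i ω) ∂μ ≤ 1 := fun i => by
    calc _ ≤ ∫⁻ _, 1 ∂μ := lintegral_mono fun ω => expNeg_le_one _
      _ = 1 := by simp
  have h1 : Tendsto (fun s : Finset ι => ∫⁻ ω, expNeg (∑ i ∈ s, f i ω) ∂μ) atTop
      (𝓝 (∫⁻ ω, expNeg (∑' i, f i ω) ∂μ)) := by
    refine tendsto_lintegral_filter_of_dominated_convergence (fun _ => 1) ?_ ?_ (by simp) ?_
    · exact .of_forall fun s => by fun_prop
    · exact .of_forall fun s => .of_forall fun ω => expNeg_le_one _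
    · exact .of_forall fun ω => (continuous_expNeg.tendsto _).comp
        (ENNReal.summable (f := fun i => f i ω)).hasSum
  have h2 : Tendsto (fun s : Finset ι => expNeg (∑ i ∈ s, negLog (∫⁻ ω, expNeg (f i ω) ∂μ))) atTop
      (𝓝 (expNeg (∑' i, negLog (∫⁻ ω, expNeg (f i ω) ∂μ)))) :=
    (continuous_expNeg.tendsto _).comp ENNReal.summable.hasSum
  refine tendsto_nhds_unique h1 (h2.congr fun s => ?_)
  simp_rw [expNeg_finset_sum, expNeg_negLog (hq _)]
  exact (lintegral_finset_prod_of_iIndepFun (hf.comp (fun _ => expNeg) fun _ => measurable_expNeg)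
    (fun i => measurable_expNeg.comp (hm i)) s).symm

/-- Fubini for the product law of the pair. It allows one group of random quantities to be frozen
while another is averaged: the signal gain, then the marks, and finally the competing distances in
the association problem. -/
lemma lintegral_eq_lintegral_lintegral_of_indepFun {β γ : Type*} [MeasurableSpace β]
    [MeasurableSpace γ] [IsProbabilityMeasure μ] {X : Ω → β} {Y : Ω → γ} (h : IndepFun X Y μ)
    (hX : Measurable X) (hY : Measurable Y) {F : β → γ → ℝ≥0∞}
    (hF : Measurable (Function.uncurry F)) :
    ∫⁻ ω, F (X ω) (Y ω) ∂μ = ∫⁻ ω, ∫⁻ ω', F (X ω) (Y ω') ∂μ ∂μ := by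
  have e := (indepFun_iff_map_prod_eq_prod_map_map hX.aemeasurable hY.aemeasurable).1 h
  have : IsProbabilityMeasure (μ.map Y) := Measure.isProbabilityMeasure_map hY.aemeasurable
  calc _ = ∫⁻ z, Function.uncurry F z ∂(μ.map fun ω => (X ω, Y ω)) :=
        (lintegral_map hF (hX.prodMk hY)).symm
    _ = ∫⁻ x, ∫⁻ y, F x y ∂(μ.map Y) ∂(μ.map X) := by
        rw [e, lintegral_prod _ hF.aemeasurable]; rfl
    _ = ∫⁻ ω, ∫⁻ y, F (X ω) y ∂(μ.map Y) ∂μ :=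
        lintegral_map hF.lintegral_prod_right' hX
    _ = _ := by
        refine lintegral_congr fun ω => lintegral_map ?_ hY
        exact hF.comp measurable_prodMk_left

/-- Integration along the fibres of a random variable with countably many values. -/
lemma lintegral_eq_tsum_fiber {j : Ω → ℕ} (hj : Measurable j) (F : ℕ → Ω → ℝ≥0∞) :
    ∫⁻ ω, F (j ω) ω ∂μ = ∑' n, ∫⁻ ω in j ⁻¹' {n}, F n ω ∂μ := by
  have hU : ⋃ n, j ⁻¹' {n} = univ := by ext; simp
  have hm : ∀ n, MeasurableSet (j ⁻¹' {n}) := fun n => hj (measurableSet_singleton n)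
  rw [← setLIntegral_univ, ← hU, lintegral_iUnion hm]
  · refine tsum_congr fun n => setLIntegral_congr_fun (hm n) fun ω hω => ?_
    simp only [mem_preimage, mem_singleton_iff] at hω
    simp [hω]
  · intro a b hab
    refine Set.disjoint_left.2 fun ω ha hb => hab ?_
    simp only [mem_preimage, mem_singleton_iff] at ha hb
    exact ha.symm.trans hb

end Independence

/-! ### Laplace functional of a Poisson process -/

/-- The probability generating function of the Poisson law. -/
lemma lintegral_pow_poissonMeasure (r : ℝ≥0) {q : ℝ≥0∞} (hq : q ≤ 1) :
    ∫⁻ n, q ^ n ∂(poissonMeasure r) = expNeg (r * (1 - q)) := by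
  lift q to ℝ≥0 using ne_top_of_le_ne_top ENNReal.one_ne_top hq
  have hq' : (q : ℝ) ≤ 1 := by exact_mod_cast hq
  rw [poissonMeasure, lintegral_sum_measure]
  simp_rw [lintegral_smul_measure, lintegral_dirac, smul_eq_mul]
  have h1 : ∀ n : ℕ, ENNReal.ofReal (Real.exp (-r) * r ^ n / n.factorial) * (q : ℝ≥0∞) ^ n =
      ENNReal.ofReal (Real.exp (-r) * ((r * q : ℝ) ^ n / n.factorial)) := fun n => by
    rw [← ENNReal.ofReal_coe_nnreal (p := q), ← ENNReal.ofReal_pow (by positivity),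
      ← ENNReal.ofReal_mul (by positivity)]
    congr 1; rw [mul_pow]; ring
  have h2 : HasSum (fun n : ℕ => Real.exp (-r) * ((r * q : ℝ) ^ n / n.factorial))
      (Real.exp (-r) * Real.exp (r * q)) := by
    rw [Real.exp_eq_exp_ℝ]
    exact (NormedSpace.expSeries_div_hasSum_exp (r * q : ℝ)).mul_left _
  simp_rw [h1]
  rw [← ENNReal.ofReal_tsum_of_nonneg (fun n => by positivity) h2.summable, h2.tsum_eq,
    ← Real.exp_add]
  have h3 : (r : ℝ≥0∞) * (1 - q) = ENNReal.ofReal (r * (1 - q)) := by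
    rw [ENNReal.ofReal_mul r.coe_nonneg, ENNReal.ofReal_sub _ q.coe_nonneg]; simp
  rw [h3, expNeg_ofReal (mul_nonneg r.coe_nonneg (by linarith))]
  congr 2; ring

/-- The sum of `f` over the points of the point collection `X n`, `n < num`. -/
noncomputable def pointSum {Ω : Type*} (num : Ω → ℕ∞) (X : ℕ → Ω → Plane) (f : Plane → ℝ≥0∞)
    (ω : Ω) : ℝ≥0∞ :=
  ∑' n : ℕ, if (n : ℕ∞) < num ω then f (X n ω) else 0

section PointSum

variable {Ω : Type*} {num : Ω → ℕ∞} {X : ℕ → Ω → Plane}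

lemma pointSum_tendsto {f : ℕ → Plane → ℝ≥0∞} {g : Plane → ℝ≥0∞} (hf : Monotone f)
    (h : ∀ x, Tendsto (fun m => f m x) atTop (𝓝 (g x))) (ω : Ω) :
    Tendsto (fun m => pointSum num X (f m) ω) atTop (𝓝 (pointSum num X g ω)) := by
  simp_rw [pointSum, ← lintegral_count]
  refine lintegral_tendsto_of_tendsto_of_monotone (fun n => (Measurable.of_discrete).aemeasurable)
    (.of_forall fun n a b hab => ?_) (.of_forall fun n => ?_)
  · dsimp only
    split_ifs
    · exact hf hab _
    · exact le_rfl
  · split_ifs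
    · exact h _
    · exact tendsto_const_nhds

lemma toENNReal_pointCount (A : Set Plane) (ω : Ω) :
    (pointCount num X A ω : ℝ≥0∞) = pointSum num X (A.indicator 1) ω := by
  classical
  rw [pointCount, ← ENNReal.tsum_set_one, tsum_subtype _ fun _ => (1 : ℝ≥0∞)]
  refine tsum_congr fun n => ?_
  simp only [indicator_apply, mem_ofPred_eq, ite_and, Pi.one_apply]

/-- The axioms of a Poisson process speak only of counts in sets; this is the bridge from counts to
sums of functions over the points. -/
lemma pointSum_simpleFunc (f : SimpleFunc Plane ℝ≥0∞) (ω : Ω) :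
    pointSum num X f ω = ∑ c ∈ f.range, c * (pointCount num X (f ⁻¹' {c}) ω : ℝ≥0∞) := by
  classical
  simp_rw [toENNReal_pointCount, pointSum, ← ENNReal.tsum_mul_left]
  rw [← Summable.tsum_finsetSum fun _ _ => ENNReal.summable]
  refine tsum_congr fun n => ?_
  by_cases hn : (n : ℕ∞) < num ω
  · simp [hn, indicator_apply]
  · simp [hn]

variable [MeasurableSpace Ω]

lemma measurable_pointSum (hnum : Measurable num) (hX : ∀ n, Measurable (X n))
    {f : Plane → ℝ≥0∞} (hf : Measurable f) : Measurable (pointSum num X f) :=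
  Measurable.tsum fun n => Measurable.ite
    (hnum (MeasurableSet.of_discrete (s := Ioi (n : ℕ∞)))) (hf.comp (hX n)) measurable_const

end PointSum

namespace IsHomogeneousPPP

variable {Ω : Type*} [MeasurableSpace Ω] {μ : Measure Ω}
  {num : Ω → ℕ∞} {X : ℕ → Ω → Plane} {lam : ℝ}

/-- This is the Poisson generating function at q = e^(-c), with c = ∞ allowed. -/
lemma lintegral_expNeg_mul_pointCount (h : IsHomogeneousPPP μ num X lam) (hlam : 0 ≤ lam)
    {A : Set Plane} (hA : MeasurableSet A) (hA' : volume A ≠ ∞) (c : ℝ≥0∞) :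
    ∫⁻ ω, expNeg (c * (pointCount num X A ω : ℝ≥0∞)) ∂μ =
      expNeg (ENNReal.ofReal lam * ((1 - expNeg c) * volume A)) := by
  have hl := h.count_law A hA hA'
  calc _ = ∫⁻ n : ℕ∞, expNeg (c * (n : ℝ≥0∞)) ∂(μ.map (pointCount num X A)) :=
        (lintegral_map' (Measurable.of_discrete (f := fun n : ℕ∞ => expNeg (c * (n : ℝ≥0∞)))).aemeasurable
          hl.aemeasurable).symm
    _ = ∫⁻ n : ℕ, expNeg c ^ n ∂(poissonMeasure (lam * (volume A).toReal).toNNReal) := by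
        rw [hl.map_eq, lintegral_map .of_discrete .of_discrete]
        simp [expNeg_mul_natCast]
    _ = _ := by
        rw [lintegral_pow_poissonMeasure _ (expNeg_le_one c)]
        congr 1
        change ENNReal.ofReal _ * _ = _
        rw [ENNReal.ofReal_mul hlam, ENNReal.ofReal_toReal hA', mul_assoc, mul_comm (volume A)]

/-- Level sets of a simple function are disjoint, so their counts are independent and the
expectation factors into Poisson generating functions. -/
lemma lintegral_expNeg_pointSum_simpleFunc [IsProbabilityMeasure μ]
    (h : IsHomogeneousPPP μ num X lam) (hlam : 0 ≤ lam)
    (f : SimpleFunc Plane ℝ≥0∞) (hf : f.FinMeasSupp volume) :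
    ∫⁻ ω, expNeg (pointSum num X f ω) ∂μ =
      expNeg (ENNReal.ofReal lam * ∫⁻ x, (1 - expNeg (f x))) := by
  classical
  -- The level set of 0 has infinite area, hence no Poisson law; it contributes to neither side and
  -- is removed.
  set R := f.range.filter (· ≠ 0) with hR
  have e1 : ∀ ω, pointSum num X f ω =
      ∑ c : R, c.1 * (pointCount num X (f ⁻¹' {c.1}) ω : ℝ≥0∞) := fun ω => by
    rw [pointSum_simpleFunc,
      Finset.sum_coe_sort R fun c => c * (pointCount num X (f ⁻¹' {c}) ω : ℝ≥0∞), hR,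
      Finset.sum_filter_of_ne]
    rintro c - hc rfl
    simp at hc
  have e2 : ∫⁻ x, (1 - expNeg (f x)) = ∑ c : R, (1 - expNeg c.1) * volume (f ⁻¹' {c.1}) := by
    have := SimpleFunc.map_lintegral (μ := (volume : Measure Plane)) (fun c => 1 - expNeg c) f
    rw [← SimpleFunc.lintegral_eq_lintegral] at this
    simp only [SimpleFunc.coe_map, Function.comp] at this
    rw [this, Finset.sum_coe_sort R fun c => (1 - expNeg c) * volume (f ⁻¹' {c}), hR,
      Finset.sum_filter_of_ne]
    rintro c - hc rfl
    simp at hc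
  have hind : iIndepFun (fun c : R => pointCount num X (f ⁻¹' {c.1})) μ := by
    have h1 := h.count_indep R.card (fun j => f ⁻¹' {(R.equivFin.symm j).1})
      (fun j => f.measurableSet_preimage _) (fun i j hij => by
        refine Disjoint.preimage _ ?_
        rw [disjoint_singleton]
        intro he
        exact hij (R.equivFin.symm.injective (Subtype.ext he)))
    simpa using h1.precomp R.equivFin.injective
  have hind' := hind.comp (fun c n => expNeg (c.1 * (n : ℝ≥0∞))) fun _ => .of_discrete
  have hm : ∀ c : R, Measurable fun ω =>
      expNeg (c.1 * (pointCount num X (f ⁻¹' {c.1}) ω : ℝ≥0∞)) := fun c => by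
    simp_rw [toENNReal_pointCount]
    exact measurable_expNeg.comp ((measurable_pointSum h.measurable_num h.measurable_point
      (measurable_one.indicator (f.measurableSet_preimage _))).const_mul _)
  simp_rw [e1, e2, expNeg_finset_sum, Finset.mul_sum, expNeg_finset_sum]
  refine (lintegral_finset_prod_of_iIndepFun hind' hm Finset.univ).trans ?_
  refine Finset.prod_congr rfl fun c _ => ?_
  refine h.lintegral_expNeg_mul_pointCount hlam (f.measurableSet_preimage _) ?_ c.1
  exact (hf.meas_preimage_singleton_ne_zero (Finset.mem_filter.1 c.2).2).ne

/-- The Laplace functional of a homogeneous Poisson point process. -/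
lemma lintegral_expNeg_pointSum [IsProbabilityMeasure μ] (h : IsHomogeneousPPP μ num X lam)
    (hlam : 0 ≤ lam) {f : Plane → ℝ≥0∞} (hf : Measurable f) :
    ∫⁻ ω, expNeg (pointSum num X f ω) ∂μ =
      expNeg (ENNReal.ofReal lam * ∫⁻ x, (1 - expNeg (f x))) := by
  -- The restriction to growing balls gives each approximant a support of finite area, without
  -- losing monotonicity or the pointwise limit.
  set F : ℕ → SimpleFunc Plane ℝ≥0∞ := fun m =>
    (SimpleFunc.eapprox f m).restrict (Metric.ball 0 m) with hF
  have hFapp : ∀ m x, F m x = (Metric.ball 0 (m : ℝ)).indicator (SimpleFunc.eapprox f m) x :=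
    fun m x => by rw [hF, SimpleFunc.restrict_apply _ measurableSet_ball]
  have hmono : Monotone fun m => (F m : Plane → ℝ≥0∞) := fun a b hab x => by
    simp only [hFapp]
    refine (indicator_le_indicator_of_subset (Metric.ball_subset_ball
      (Nat.cast_le.2 hab)) (fun _ => zero_le) x).trans ?_
    exact indicator_le_indicator (SimpleFunc.monotone_eapprox f hab x)
  have htend : ∀ x, Tendsto (fun m => F m x) atTop (𝓝 (f x)) := fun x => by
    have h1 : Tendsto (fun m => SimpleFunc.eapprox f m x) atTop (𝓝 (f x)) := by
      rw [← SimpleFunc.iSup_eapprox_apply hf x]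
      exact tendsto_atTop_iSup fun a b hab => SimpleFunc.monotone_eapprox f hab x
    refine h1.congr' ?_
    obtain ⟨k, hk⟩ := exists_nat_gt ‖x‖
    filter_upwards [eventually_ge_atTop k] with m hm
    rw [hFapp, indicator_of_mem]
    rw [mem_ball_zero_iff]
    exact hk.trans_le (by exact_mod_cast hm)
  have hfin : ∀ m, (F m).FinMeasSupp volume := fun m => by
    rw [SimpleFunc.finMeasSupp_iff_support]
    refine (measure_mono ?_).trans_lt (measure_ball_lt_top (x := (0 : Plane)) (r := m))
    intro x hx
    by_contra hx'
    exact hx (by rw [hFapp, indicator_of_notMem hx'])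
  have h1 : Tendsto (fun m => ∫⁻ ω, expNeg (pointSum num X (F m) ω) ∂μ) atTop
      (𝓝 (∫⁻ ω, expNeg (pointSum num X f ω) ∂μ)) := by
    refine tendsto_lintegral_of_dominated_convergence (fun _ => 1) (fun m => ?_)
      (fun m => .of_forall fun ω => expNeg_le_one _) (by simp) (.of_forall fun ω => ?_)
    · exact measurable_expNeg.comp
        (measurable_pointSum h.measurable_num h.measurable_point (F m).measurable)
    · exact (continuous_expNeg.tendsto _).comp (pointSum_tendsto hmono htend ω)
  have h2 : Tendsto (fun m => ∫⁻ x, (1 - expNeg (F m x))) atTop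
      (𝓝 (∫⁻ x, (1 - expNeg (f x)))) := by
    refine lintegral_tendsto_of_tendsto_of_monotone (fun m => ?_) (.of_forall fun x => ?_)
      (.of_forall fun x => ?_)
    · exact (measurable_const.sub (measurable_expNeg.comp (F m).measurable)).aemeasurable
    · exact fun a b hab => tsub_le_tsub_left (expNeg_antitone (hmono hab x)) _
    · exact ENNReal.Tendsto.sub tendsto_const_nhds
        ((continuous_expNeg.tendsto _).comp (htend x)) (Or.inl ENNReal.one_ne_top)
  have h3 := (continuous_expNeg.tendsto _).comp
    (ENNReal.Tendsto.const_mul h2 (Or.inr (ENNReal.ofReal_ne_top (r := lam))))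
  refine tendsto_nhds_unique h1 (h3.congr fun m => ?_)
  exact (h.lintegral_expNeg_pointSum_simpleFunc hlam (F m) (hfin m)).symm

end IsHomogeneousPPP

/-! ### Distance to the nearest point -/

/-- The distance from the origin to the nearest point of the superposition of the point collections
in `U` (`∞` if there is no point). -/
noncomputable def nearestDist {Ω κ : Type*} (num : κ → Ω → ℕ∞) (X : κ → ℕ → Ω → Plane)
    (U : Finset κ) (ω : Ω) : ℝ≥0∞ :=
  ⨅ k ∈ U, ⨅ n : ℕ, ⨅ _ : (n : ℕ∞) < num k ω, (‖X k n ω‖₊ : ℝ≥0∞)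

section NearestDist

variable {Ω κ : Type*} {num : κ → Ω → ℕ∞} {X : κ → ℕ → Ω → Plane} {U : Finset κ}

lemma le_nearestDist_iff {a : ℝ≥0∞} {ω : Ω} :
    a ≤ nearestDist num X U ω ↔
      ∀ k ∈ U, ∀ n : ℕ, (n : ℕ∞) < num k ω → a ≤ (‖X k n ω‖₊ : ℝ≥0∞) := by
  simp [nearestDist]

lemma nearestDist_lt_iff {a : ℝ≥0∞} {ω : Ω} :
    nearestDist num X U ω < a ↔
      ∃ k ∈ U, ∃ n : ℕ, (n : ℕ∞) < num k ω ∧ (‖X k n ω‖₊ : ℝ≥0∞) < a := by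
  rw [← not_le, le_nearestDist_iff]
  push Not
  rfl

/-- A single point in the open disk makes the sum infinite. Thus the event that the disk is empty is
itself an exponential of a point sum. -/
lemma expNeg_sum_pointSum_void (a : ℝ≥0) (ω : Ω) :
    expNeg (∑ k ∈ U, pointSum (num k) (X k) ({x | ‖x‖₊ < a}.indicator fun _ => ∞) ω) =
      {ω | (a : ℝ≥0∞) ≤ nearestDist num X U ω}.indicator 1 ω := by
  by_cases h : (a : ℝ≥0∞) ≤ nearestDist num X U ω
  · rw [indicator_of_mem (by exact h)]
    rw [le_nearestDist_iff] at h
    rw [Finset.sum_eq_zero, expNeg_zero, Pi.one_apply]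
    intro k hk
    refine ENNReal.tsum_eq_zero.2 fun n => ?_
    split_ifs with hn
    · rw [indicator_of_notMem]
      have := h k hk n hn
      simpa using this
    · rfl
  · rw [indicator_of_notMem (by exact h)]
    rw [not_le, nearestDist_lt_iff] at h
    obtain ⟨k, hk, n, hn, hX⟩ := h
    rw [← expNeg_top]
    congr 1
    refine ENNReal.sum_eq_top.2 ⟨k, hk, ENNReal.tsum_eq_top_of_eq_top ⟨n, ?_⟩⟩
    rw [if_pos hn, indicator_of_mem]
    simpa using hX

variable [MeasurableSpace Ω]

lemma measurable_nearestDist (hnum : ∀ k, Measurable (num k)) (hX : ∀ k n, Measurable (X k n)) :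
    Measurable (nearestDist num X U) := by
  refine Measurable.biInf (U : Set κ) U.countable_toSet fun k _ => Measurable.iInf fun n => ?_
  have : (fun ω => ⨅ _ : (n : ℕ∞) < num k ω, (‖X k n ω‖₊ : ℝ≥0∞)) =
      fun ω => if (n : ℕ∞) < num k ω then (‖X k n ω‖₊ : ℝ≥0∞) else ∞ := by
    ext ω
    rw [iInf_eq_if]
  rw [this]
  exact Measurable.ite (hnum k (MeasurableSet.of_discrete (s := Ioi (n : ℕ∞))))
    (hX k n).nnnorm.coe_nnreal_ennreal measurable_const

end NearestDist

lemma measurable_comp_nat {Ω β : Type*} [MeasurableSpace Ω] [MeasurableSpace β] {j : Ω → ℕ}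
    (hj : Measurable j) {F : ℕ → Ω → β} (hF : ∀ n, Measurable (F n)) :
    Measurable fun ω => F (j ω) ω :=
  (measurable_from_prod_countable_right (f := fun z : ℕ × Ω => F z.1 z.2) hF).comp
    (hj.prodMk measurable_id)

/-! ### Superpositions restricted to void events and shells -/

section Superposition

variable {Ω κ : Type*} [MeasurableSpace Ω] {μ : Measure Ω} [IsProbabilityMeasure μ]
  {num : κ → Ω → ℕ∞} {X : κ → ℕ → Ω → Plane} {lam : κ → ℝ}

/-- The Laplace functional of a superposition of independent Poisson processes. -/
lemma lintegral_expNeg_sum_pointSum (hppp : ∀ k, IsHomogeneousPPP μ (num k) (X k) (lam k))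
    (hind : iIndepFun (fun k ω => (num k ω, fun n => X k n ω)) μ) (hlam : ∀ k, 0 ≤ lam k)
    (U : Finset κ) {f : κ → Plane → ℝ≥0∞} (hf : ∀ k, Measurable (f k)) :
    ∫⁻ ω, expNeg (∑ k ∈ U, pointSum (num k) (X k) (f k) ω) ∂μ =
      expNeg (∑ k ∈ U, ENNReal.ofReal (lam k) * ∫⁻ x, (1 - expNeg (f k x))) := by
  simp_rw [expNeg_finset_sum]
  have hm : ∀ k, Measurable fun ω => expNeg (pointSum (num k) (X k) (f k) ω) := fun k =>
    measurable_expNeg.comp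
      (measurable_pointSum (hppp k).measurable_num (hppp k).measurable_point (hf k))
  have hind' := hind.comp (fun k c => expNeg (pointSum (Ω := ℕ∞ × (ℕ → Plane)) Prod.fst
    (fun n c => c.2 n) (f k) c)) fun k => measurable_expNeg.comp
      (measurable_pointSum measurable_fst (fun n => by fun_prop) (hf k))
  refine (lintegral_finset_prod_of_iIndepFun hind' hm U).trans ?_
  exact Finset.prod_congr rfl fun k _ => (hppp k).lintegral_expNeg_pointSum (hlam k) (hf k)

/-- Adding the weight ∞ on the disk to f inserts the indicator of the void event into the Laplace
functional. -/
lemma setLIntegral_expNeg_of_le_nearestDist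
    (hppp : ∀ k, IsHomogeneousPPP μ (num k) (X k) (lam k))
    (hind : iIndepFun (fun k ω => (num k ω, fun n => X k n ω)) μ) (hlam : ∀ k, 0 ≤ lam k)
    (U : Finset κ) {f : κ → Plane → ℝ≥0∞} (hf : ∀ k, Measurable (f k)) (a : ℝ≥0)
    (hfa : ∀ k x, ‖x‖₊ < a → f k x = 0) :
    ∫⁻ ω in {ω | (a : ℝ≥0∞) ≤ nearestDist num X U ω},
        expNeg (∑ k ∈ U, pointSum (num k) (X k) (f k) ω) ∂μ =
      expNeg (∑ k ∈ U, ENNReal.ofReal (lam k) * volume {x : Plane | ‖x‖₊ < a}) *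
      expNeg (∑ k ∈ U, ENNReal.ofReal (lam k) * ∫⁻ x, (1 - expNeg (f k x))) := by
  classical
  have hA : MeasurableSet {x : Plane | ‖x‖₊ < a} := measurableSet_lt measurable_nnnorm measurable_const
  have hD : MeasurableSet {ω | (a : ℝ≥0∞) ≤ nearestDist num X U ω} :=
    measurableSet_le measurable_const (measurable_nearestDist (fun k => (hppp k).measurable_num)
      fun k => (hppp k).measurable_point)
  set v : Plane → ℝ≥0∞ := {x | ‖x‖₊ < a}.indicator fun _ => ∞ with hv
  have hvm : Measurable v := measurable_const.indicator hA
  have h1 := lintegral_expNeg_sum_pointSum hppp hind hlam U (f := fun k x => v x + f k x)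
    fun k => hvm.add (hf k)
  have h2 : ∀ k ω, pointSum (num k) (X k) (fun x => v x + f k x) ω =
      pointSum (num k) (X k) v ω + pointSum (num k) (X k) (f k) ω := fun k ω => by
    rw [pointSum, pointSum, pointSum, ← ENNReal.tsum_add]
    refine tsum_congr fun n => ?_
    split_ifs <;> simp
  -- The weights v and f have disjoint supports, so the exponent splits additively: the void event
  -- and the points beyond the disk decouple.
  have h3 : ∀ k x, 1 - expNeg (v x + f k x) =
      {x : Plane | ‖x‖₊ < a}.indicator 1 x + (1 - expNeg (f k x)) := fun k x => by
    by_cases hx : ‖x‖₊ < a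
    · simp [hv, hx, hfa k x hx]
    · simp [hv, hx]
  have h4 : ∀ k, ∫⁻ x, (1 - expNeg (v x + f k x)) =
      volume {x : Plane | ‖x‖₊ < a} + ∫⁻ x, (1 - expNeg (f k x)) := fun k => by
    simp_rw [h3]
    rw [lintegral_add_left (measurable_one.indicator hA), lintegral_indicator_one hA]
  simp_rw [h2, h4, Finset.sum_add_distrib, expNeg_add, mul_add, Finset.sum_add_distrib,
    expNeg_add] at h1
  rw [← h1, ← lintegral_indicator hD]
  refine lintegral_congr fun ω => ?_
  rw [hv, expNeg_sum_pointSum_void]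
  by_cases hω : ω ∈ {ω | (a : ℝ≥0∞) ≤ nearestDist num X U ω}
  · simp [indicator_of_mem hω]
  · simp [indicator_of_notMem hω]

lemma measure_le_nearestDist (hppp : ∀ k, IsHomogeneousPPP μ (num k) (X k) (lam k))
    (hind : iIndepFun (fun k ω => (num k ω, fun n => X k n ω)) μ) (hlam : ∀ k, 0 ≤ lam k)
    (U : Finset κ) (a : ℝ≥0) :
    μ {ω | (a : ℝ≥0∞) ≤ nearestDist num X U ω} =
      expNeg (∑ k ∈ U, ENNReal.ofReal (lam k) * volume {x : Plane | ‖x‖₊ < a}) := by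
  have := setLIntegral_expNeg_of_le_nearestDist hppp hind hlam U (f := fun _ _ => 0)
    (fun _ => measurable_const) a (fun _ _ _ => rfl)
  simpa [pointSum] using this

/-- On a shell containing the nearest point, the points beyond the shell are not affected by the
conditioning. -/
lemma setLIntegral_expNeg_shell (hppp : ∀ k, IsHomogeneousPPP μ (num k) (X k) (lam k))
    (hind : iIndepFun (fun k ω => (num k ω, fun n => X k n ω)) μ) (hlam : ∀ k, 0 ≤ lam k)
    (U : Finset κ) {f : κ → Plane → ℝ≥0∞} (hf : ∀ k, Measurable (f k)) {a b : ℝ≥0} (hab : a ≤ b)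
    (hfb : ∀ k x, ‖x‖₊ < b → f k x = 0) :
    ∫⁻ ω in {ω | (a : ℝ≥0∞) ≤ nearestDist num X U ω ∧ nearestDist num X U ω < b},
        expNeg (∑ k ∈ U, pointSum (num k) (X k) (f k) ω) ∂μ =
      μ {ω | (a : ℝ≥0∞) ≤ nearestDist num X U ω ∧ nearestDist num X U ω < b} *
      expNeg (∑ k ∈ U, ENNReal.ofReal (lam k) * ∫⁻ x, (1 - expNeg (f k x))) := by
  set D := nearestDist num X U
  set e := expNeg (∑ k ∈ U, ENNReal.ofReal (lam k) * ∫⁻ x, (1 - expNeg (f k x)))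
  have hDm : Measurable D := measurable_nearestDist (fun k => (hppp k).measurable_num)
      fun k => (hppp k).measurable_point
  have hb : MeasurableSet {ω | (b : ℝ≥0∞) ≤ D ω} := measurableSet_le measurable_const hDm
  have hU : {ω | (a : ℝ≥0∞) ≤ D ω} =
      {ω | (a : ℝ≥0∞) ≤ D ω ∧ D ω < b} ∪ {ω | (b : ℝ≥0∞) ≤ D ω} := by
    ext ω
    have : (a : ℝ≥0∞) ≤ b := by exact_mod_cast hab
    simp only [mem_ofPred_eq, mem_union]
    constructor
    · intro h
      rcases lt_or_ge (D ω) b with h' | h'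
      · exact Or.inl ⟨h, h'⟩
      · exact Or.inr h'
    · rintro (h | h)
      · exact h.1
      · exact this.trans h
  have hdisj : Disjoint {ω | (a : ℝ≥0∞) ≤ D ω ∧ D ω < b} {ω | (b : ℝ≥0∞) ≤ D ω} :=
    Set.disjoint_left.2 fun ω h h' => not_le_of_gt h.2 h'
  have ha := setLIntegral_expNeg_of_le_nearestDist hppp hind hlam U hf a
    fun k x hx => hfb k x (hx.trans_le hab)
  have hb' := setLIntegral_expNeg_of_le_nearestDist hppp hind hlam U hf b hfb
  rw [← measure_le_nearestDist hppp hind hlam U] at ha hb'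
  change ∫⁻ ω in {ω | (a : ℝ≥0∞) ≤ D ω}, _ ∂μ = μ {ω | (a : ℝ≥0∞) ≤ D ω} * e at ha
  change ∫⁻ ω in {ω | (b : ℝ≥0∞) ≤ D ω}, _ ∂μ = μ {ω | (b : ℝ≥0∞) ≤ D ω} * e at hb'
  -- Both void identities carry the same factor `e`. Removing the event D ≥ b from D ≥ a leaves the
  -- shell; the cancellation in [0, ∞] is valid because the removed term is finite.
  rw [hU, lintegral_union hb hdisj, measure_union hdisj hb, hb', add_mul] at ha
  exact (ENNReal.add_left_inj (ENNReal.mul_ne_top (measure_ne_top _ _) (expNeg_ne_top _))).1 ha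

end Superposition

/-! ### Dyadic discretization of the nearest distance -/

/-- The largest multiple of `2⁻ᵐ` below `r`. -/
noncomputable def dyadicFloor (m : ℕ) (r : ℝ≥0) : ℝ≥0 := (⌊2 ^ m * r⌋₊ : ℝ≥0) / 2 ^ m

lemma dyadicFloor_le (m : ℕ) (r : ℝ≥0) : dyadicFloor m r ≤ r := by
  rw [dyadicFloor, div_le_iff₀ (by positivity), mul_comm]
  exact Nat.floor_le (by positivity)

lemma lt_dyadicFloor_add (m : ℕ) (r : ℝ≥0) : r < dyadicFloor m r + 1 / 2 ^ m := by
  rw [dyadicFloor, ← add_div, lt_div_iff₀ (by positivity), mul_comm]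
  exact Nat.lt_floor_add_one _

lemma dyadicFloor_mono (r : ℝ≥0) : Monotone fun m => dyadicFloor m r := by
  refine monotone_nat_of_le_succ fun m => ?_
  rw [dyadicFloor, dyadicFloor, div_le_div_iff₀ (by positivity) (by positivity), pow_succ]
  have h : 2 * ⌊2 ^ m * r⌋₊ ≤ ⌊2 ^ m * 2 * r⌋₊ := by
    refine Nat.le_floor ?_
    push_cast
    calc 2 * (⌊2 ^ m * r⌋₊ : ℝ≥0) ≤ 2 * (2 ^ m * r) := by gcongr; exact Nat.floor_le (by positivity)
      _ = _ := by ring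
  have h' : 2 * (⌊2 ^ m * r⌋₊ : ℝ≥0) ≤ (⌊2 ^ m * 2 * r⌋₊ : ℝ≥0) := by exact_mod_cast h
  calc (⌊2 ^ m * r⌋₊ : ℝ≥0) * (2 ^ m * 2) = 2 * (⌊2 ^ m * r⌋₊ : ℝ≥0) * 2 ^ m := by ring
    _ ≤ _ := by gcongr

/-- The right end of the dyadic interval containing r decreases as the mesh is refined, so the
cut-off region of the weights shrinks and monotone convergence applies. -/
lemma dyadicFloor_add_anti (r : ℝ≥0) : Antitone fun m => dyadicFloor m r + 1 / 2 ^ m := by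
  refine antitone_nat_of_succ_le fun m => ?_
  rw [dyadicFloor, dyadicFloor, ← add_div, ← add_div,
    div_le_div_iff₀ (by positivity) (by positivity), pow_succ]
  have h : ⌊2 ^ m * 2 * r⌋₊ + 1 ≤ 2 * ⌊2 ^ m * r⌋₊ + 2 := by
    rw [Nat.succ_le_iff, Nat.floor_lt (by positivity)]
    push_cast
    calc 2 ^ m * 2 * r = 2 * (2 ^ m * r) := by ring
      _ < 2 * (⌊2 ^ m * r⌋₊ + 1) := by gcongr; exact Nat.lt_floor_add_one _
      _ = _ := by ring
  have h' : (⌊2 ^ m * 2 * r⌋₊ : ℝ≥0) + 1 ≤ 2 * (⌊2 ^ m * r⌋₊ : ℝ≥0) + 2 := by exact_mod_cast h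
  calc ((⌊2 ^ m * 2 * r⌋₊ : ℝ≥0) + 1) * 2 ^ m ≤ (2 * (⌊2 ^ m * r⌋₊ : ℝ≥0) + 2) * 2 ^ m := by gcongr
    _ = _ := by ring

lemma tendsto_dyadic_unit : Tendsto (fun m : ℕ => (1 : ℝ≥0) / 2 ^ m) atTop (𝓝 0) := by
  have := tendsto_pow_atTop_nhds_zero_of_lt_one (r := (1 / 2 : ℝ≥0)) zero_le
    (by rw [← NNReal.coe_lt_coe]; push_cast; norm_num)
  simpa [div_eq_mul_inv] using this

lemma tendsto_dyadicFloor (r : ℝ≥0) : Tendsto (fun m => dyadicFloor m r) atTop (𝓝 r) := by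
  have h : Tendsto (fun m : ℕ => r - 1 / 2 ^ m) atTop (𝓝 r) := by
    simpa using (tendsto_const_nhds (x := r)).sub tendsto_dyadic_unit
  exact tendsto_of_tendsto_of_tendsto_of_le_of_le h tendsto_const_nhds
    (fun m => tsub_le_iff_right.2 (lt_dyadicFloor_add m r).le) fun m => dyadicFloor_le m r

lemma tendsto_dyadicFloor_add (r : ℝ≥0) :
    Tendsto (fun m => dyadicFloor m r + 1 / 2 ^ m) atTop (𝓝 r) := by
  simpa using (tendsto_dyadicFloor r).add tendsto_dyadic_unit

section Superposition

variable {Ω κ : Type*} [MeasurableSpace Ω] {μ : Measure Ω} [IsProbabilityMeasure μ]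
  {num : κ → Ω → ℕ∞} {X : κ → ℕ → Ω → Plane} {lam : κ → ℝ}

/-- On a fibre of the dyadic index both the weight and the cut-off are deterministic, and the weight
vanishes up to the outer radius of the shell. The shell identity therefore applies on each fibre,
and the fibres are summed. -/
lemma lintegral_expNeg_dyadic (hppp : ∀ k, IsHomogeneousPPP μ (num k) (X k) (lam k))
    (hind : iIndepFun (fun k ω => (num k ω, fun n => X k n ω)) μ) (hlam : ∀ k, 0 ≤ lam k)
    (U : Finset κ) (hfin : ∀ᵐ ω ∂μ, nearestDist num X U ω ≠ ∞)
    {f : κ → ℝ≥0 → Plane → ℝ≥0∞} (hf : ∀ k r, Measurable (f k r)) (C : ℝ≥0 → ℝ≥0∞) (m : ℕ)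
    {R : Ω → ℝ≥0} (hR : R = fun ω => (nearestDist num X U ω).toNNReal) :
    ∫⁻ ω, expNeg (C (dyadicFloor m (R ω)) + ∑ k ∈ U, pointSum (num k) (X k)
        (fun x => if ‖x‖₊ < dyadicFloor m (R ω) + 1 / 2 ^ m then 0
          else f k (dyadicFloor m (R ω)) x) ω) ∂μ =
    ∫⁻ ω, expNeg (C (dyadicFloor m (R ω)) + ∑ k ∈ U, ENNReal.ofReal (lam k) *
        ∫⁻ x, (1 - expNeg (if ‖x‖₊ < dyadicFloor m (R ω) + 1 / 2 ^ m then 0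
          else f k (dyadicFloor m (R ω)) x))) ∂μ := by
  have hDm : Measurable (nearestDist num X U) :=
    measurable_nearestDist (fun k => (hppp k).measurable_num) fun k => (hppp k).measurable_point
  have hRm : Measurable R := hR ▸ hDm.ennreal_toNNReal
  have hj : Measurable fun ω => ⌊2 ^ m * R ω⌋₊ := Nat.measurable_floor.comp (hRm.const_mul _)
  set g : ℕ → κ → Plane → ℝ≥0∞ := fun j k x =>
    if ‖x‖₊ < (j : ℝ≥0) / 2 ^ m + 1 / 2 ^ m then 0 else f k ((j : ℝ≥0) / 2 ^ m) x with hg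
  have hgm : ∀ j k, Measurable (g j k) := fun j k =>
    Measurable.ite (measurableSet_lt measurable_nnnorm measurable_const) measurable_const (hf _ _)
  have e1 := lintegral_eq_tsum_fiber (μ := μ) hj fun j ω => expNeg (C ((j : ℝ≥0) / 2 ^ m) +
    ∑ k ∈ U, pointSum (num k) (X k) (g j k) ω)
  have e2 := lintegral_eq_tsum_fiber (μ := μ) hj fun j _ => expNeg (C ((j : ℝ≥0) / 2 ^ m) +
    ∑ k ∈ U, ENNReal.ofReal (lam k) * ∫⁻ x, (1 - expNeg (g j k x)))
  refine e1.trans (Eq.trans (tsum_congr fun j => ?_) e2.symm)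
  -- Only almost sure equality holds: where there is no point the nearest distance is ∞ and `R`
  -- takes the default value 0.
  have hset : (fun ω => ⌊2 ^ m * R ω⌋₊) ⁻¹' {j} =ᵐ[μ]
      {ω | (((j : ℝ≥0) / 2 ^ m : ℝ≥0) : ℝ≥0∞) ≤ nearestDist num X U ω ∧
        nearestDist num X U ω < ((j : ℝ≥0) / 2 ^ m + 1 / 2 ^ m : ℝ≥0)} := by
    rw [eventuallyEq_set]
    filter_upwards [hfin] with ω hω
    have hD : nearestDist num X U ω = (R ω : ℝ≥0∞) := by rw [hR, ENNReal.coe_toNNReal hω]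
    simp only [mem_preimage, mem_singleton_iff, hD, ENNReal.coe_le_coe,
      ENNReal.coe_lt_coe]
    rw [Nat.floor_eq_iff (by positivity), ← add_div, div_le_iff₀ (by positivity),
      lt_div_iff₀ (by positivity), mul_comm]
  rw [setLIntegral_congr hset, setLIntegral_congr hset, setLIntegral_const]
  simp_rw [expNeg_add]
  rw [lintegral_const_mul' _ _ (expNeg_ne_top _),
    setLIntegral_expNeg_shell hppp hind hlam U (hgm j) (by simp) fun k x hx => if_pos hx]
  ring

/-- The points beyond the nearest point form a Poisson process, given the distance to the nearest
point. -/
lemma lintegral_expNeg_beyond_nearestDist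
    (hppp : ∀ k, IsHomogeneousPPP μ (num k) (X k) (lam k))
    (hind : iIndepFun (fun k ω => (num k ω, fun n => X k n ω)) μ) (hlam : ∀ k, 0 ≤ lam k)
    (U : Finset κ) (hfin : ∀ᵐ ω ∂μ, nearestDist num X U ω ≠ ∞)
    {f : κ → ℝ≥0 → Plane → ℝ≥0∞} (hf : ∀ k r, Measurable (f k r))
    (hfmono : ∀ k x, Monotone fun r => f k r x) (hfcont : ∀ k x, Continuous fun r => f k r x)
    {C : ℝ≥0 → ℝ≥0∞} (hC : Continuous C)
    {R : Ω → ℝ≥0} (hR : R = fun ω => (nearestDist num X U ω).toNNReal) :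
    ∫⁻ ω, expNeg (C (R ω) + ∑ k ∈ U, pointSum (num k) (X k)
        (fun x => if ‖x‖₊ ≤ R ω then 0 else f k (R ω) x) ω) ∂μ =
    ∫⁻ ω, expNeg (C (R ω) + ∑ k ∈ U, ENNReal.ofReal (lam k) *
        ∫⁻ x, (1 - expNeg (if ‖x‖₊ ≤ R ω then 0 else f k (R ω) x))) ∂μ := by
  have hDm : Measurable (nearestDist num X U) :=
    measurable_nearestDist (fun k => (hppp k).measurable_num) fun k => (hppp k).measurable_point
  have hRm : Measurable R := hR ▸ hDm.ennreal_toNNReal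
  have hj : ∀ m : ℕ, Measurable fun ω => ⌊2 ^ m * R ω⌋₊ := fun m =>
    Nat.measurable_floor.comp (hRm.const_mul _)
  -- The weight is frozen at the left end of the dyadic interval and cut off at its right end. Since
  -- f increases in r, both changes make `G` increase with m.
  set G : ℕ → ℝ≥0 → κ → Plane → ℝ≥0∞ := fun m r k x =>
    if ‖x‖₊ < dyadicFloor m r + 1 / 2 ^ m then 0 else f k (dyadicFloor m r) x with hG
  have hGm : ∀ m r k, Measurable (G m r k) := fun m r k =>
    Measurable.ite (measurableSet_lt measurable_nnnorm measurable_const) measurable_const (hf _ _)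
  have hGmono : ∀ r k, Monotone fun m => G m r k := fun r k a b hab x => by
    by_cases hx : ‖x‖₊ < dyadicFloor a r + 1 / 2 ^ a
    · simp only [hG, if_pos hx, zero_le]
    · have hx' : ¬ ‖x‖₊ < dyadicFloor b r + 1 / 2 ^ b := fun h =>
        hx (h.trans_le (dyadicFloor_add_anti r hab))
      simp only [hG, hx, hx', if_false]
      exact hfmono k x (dyadicFloor_mono r hab)
  -- Because r lies strictly below the right end, points at distance exactly r are cut off at every
  -- stage. The limit thus has `≤` and excludes the nearest point itself.
  have hGtend : ∀ r k x, Tendsto (fun m => G m r k x) atTop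
      (𝓝 (if ‖x‖₊ ≤ r then 0 else f k r x)) := fun r k x => by
    by_cases hx : ‖x‖₊ ≤ r
    · simp only [hG, if_pos hx, if_pos (hx.trans_lt (lt_dyadicFloor_add _ r)), tendsto_const_nhds]
    · rw [if_neg hx]
      refine (((hfcont k x).tendsto r).comp (tendsto_dyadicFloor r)).congr' ?_
      filter_upwards [(tendsto_dyadicFloor_add r).eventually_lt_const (not_le.1 hx)] with m hm
      simp only [hG, if_neg hm.not_gt, Function.comp_apply]
  have hCt : ∀ r, Tendsto (fun m => C (dyadicFloor m r)) atTop (𝓝 (C r)) := fun r =>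
    (hC.tendsto r).comp (tendsto_dyadicFloor r)
  have h1 : Tendsto (fun m => ∫⁻ ω, expNeg (C (dyadicFloor m (R ω)) +
      ∑ k ∈ U, pointSum (num k) (X k) (G m (R ω) k) ω) ∂μ) atTop
      (𝓝 (∫⁻ ω, expNeg (C (R ω) + ∑ k ∈ U, pointSum (num k) (X k)
        (fun x => if ‖x‖₊ ≤ R ω then 0 else f k (R ω) x) ω) ∂μ)) := by
    refine tendsto_lintegral_of_dominated_convergence (fun _ => 1) (fun m => ?_)
      (fun m => .of_forall fun ω => expNeg_le_one _) (by simp) (.of_forall fun ω => ?_)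
    · refine measurable_comp_nat (hj m) (F := fun j ω => expNeg (C ((j : ℝ≥0) / 2 ^ m) +
        ∑ k ∈ U, pointSum (num k) (X k) (fun x => if ‖x‖₊ < (j : ℝ≥0) / 2 ^ m + 1 / 2 ^ m then 0
          else f k ((j : ℝ≥0) / 2 ^ m) x) ω)) fun j => ?_
      refine measurable_expNeg.comp (measurable_const.add (Finset.measurable_fun_sum _ fun k _ =>
        measurable_pointSum (hppp k).measurable_num (hppp k).measurable_point
          (Measurable.ite (measurableSet_lt measurable_nnnorm measurable_const)
            measurable_const (hf _ _))))
    · refine (continuous_expNeg.tendsto _).comp ((hCt _).add (tendsto_finsetSum _ fun k _ => ?_))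
      exact pointSum_tendsto (hGmono (R ω) k) (hGtend (R ω) k) ω
  have h2 : Tendsto (fun m => ∫⁻ ω, expNeg (C (dyadicFloor m (R ω)) +
      ∑ k ∈ U, ENNReal.ofReal (lam k) * ∫⁻ x, (1 - expNeg (G m (R ω) k x))) ∂μ) atTop
      (𝓝 (∫⁻ ω, expNeg (C (R ω) + ∑ k ∈ U, ENNReal.ofReal (lam k) *
        ∫⁻ x, (1 - expNeg (if ‖x‖₊ ≤ R ω then 0 else f k (R ω) x))) ∂μ)) := by
    refine tendsto_lintegral_of_dominated_convergence (fun _ => 1) (fun m => ?_)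
      (fun m => .of_forall fun ω => expNeg_le_one _) (by simp) (.of_forall fun ω => ?_)
    · exact measurable_comp_nat (hj m) (F := fun j _ => expNeg (C ((j : ℝ≥0) / 2 ^ m) +
        ∑ k ∈ U, ENNReal.ofReal (lam k) * ∫⁻ x, (1 - expNeg
          (if ‖x‖₊ < (j : ℝ≥0) / 2 ^ m + 1 / 2 ^ m then 0 else f k ((j : ℝ≥0) / 2 ^ m) x))))
        fun j => measurable_const
    · refine (continuous_expNeg.tendsto _).comp ((hCt _).add (tendsto_finsetSum _ fun k _ => ?_))
      refine ENNReal.Tendsto.const_mul ?_ (Or.inr ENNReal.ofReal_ne_top)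
      refine lintegral_tendsto_of_tendsto_of_monotone (fun m => ?_) (.of_forall fun x => ?_)
        (.of_forall fun x => ?_)
      · exact (measurable_const.sub (measurable_expNeg.comp (hGm m _ k))).aemeasurable
      · exact fun a b hab => tsub_le_tsub_left (expNeg_antitone (hGmono _ k hab x)) _
      · exact ENNReal.Tendsto.sub tendsto_const_nhds
          ((continuous_expNeg.tendsto _).comp (hGtend _ k x)) (Or.inl ENNReal.one_ne_top)
  exact tendsto_nhds_unique h1 (h2.congr fun m =>
    (lintegral_expNeg_dyadic hppp hind hlam U hfin hf C m hR).symm)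

end Superposition

/-! ### Polar coordinates and the law of the nearest distance -/

lemma volume_nnnorm_lt (a : ℝ≥0) :
    volume {x : Plane | ‖x‖₊ < a} = ENNReal.ofReal (Real.pi * (a : ℝ) ^ 2) := by
  have h : {x : Plane | ‖x‖₊ < a} = Metric.ball 0 (a : ℝ) := by
    ext x
    simp [← NNReal.coe_lt_coe]
  rw [h, EuclideanSpace.volume_ball_fin_two, ← ENNReal.ofReal_pow a.coe_nonneg,
    ← ENNReal.ofReal_mul (by positivity), mul_comm]

/-- The image of the area measure under `x ↦ ‖x‖² / r²`. -/
lemma map_norm_sq_div_volume {r : ℝ} (hr : 0 < r) :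
    (volume : Measure Plane).map (fun x => ‖x‖ ^ 2 / r ^ 2) =
      ENNReal.ofReal (Real.pi * r ^ 2) • (volume : Measure ℝ).restrict (Ioi 0) := by
  have hm : Measurable fun x : Plane => ‖x‖ ^ 2 / r ^ 2 := by fun_prop
  have h1 : ∀ t : ℝ, (volume : Measure Plane).map (fun x => ‖x‖ ^ 2 / r ^ 2) (Iio t) =
      ENNReal.ofReal (Real.pi * r ^ 2 * t) := fun t => by
    rw [Measure.map_apply hm measurableSet_Iio]
    rcases lt_or_ge t 0 with ht | ht
    · rw [ENNReal.ofReal_of_nonpos (mul_nonpos_of_nonneg_of_nonpos (by positivity) ht.le)]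
      have : (fun x : Plane => ‖x‖ ^ 2 / r ^ 2) ⁻¹' Iio t = ∅ := by
        ext x
        simp only [mem_preimage, mem_Iio, mem_empty_iff_false, iff_false, not_lt]
        exact ht.le.trans (by positivity)
      rw [this, measure_empty]
    · obtain ⟨a, ha⟩ : ∃ a : ℝ≥0, (a : ℝ) = r * √t := ⟨NNReal.mk (r * √t) (by positivity), rfl⟩
      have : (fun x : Plane => ‖x‖ ^ 2 / r ^ 2) ⁻¹' Iio t = {x : Plane | ‖x‖₊ < a} := by
        ext x
        simp only [mem_preimage, mem_Iio, mem_ofPred_eq, ← NNReal.coe_lt_coe, coe_nnnorm, ha]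
        rw [div_lt_iff₀ (by positivity), ← sq_lt_sq₀ (norm_nonneg x) (by positivity), mul_pow,
          Real.sq_sqrt ht, mul_comm]
      rw [this, volume_nnnorm_lt, ha, mul_pow, Real.sq_sqrt ht, mul_assoc]
  have h2 : ∀ t : ℝ, (ENNReal.ofReal (Real.pi * r ^ 2) • (volume : Measure ℝ).restrict (Ioi 0))
      (Iio t) = ENNReal.ofReal (Real.pi * r ^ 2 * t) := fun t => by
    rw [Measure.smul_apply, Measure.restrict_apply measurableSet_Iio, inter_comm, Ioi_inter_Iio,
      Real.volume_Ioo, sub_zero, smul_eq_mul, ← ENNReal.ofReal_mul (by positivity)]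
  have h3 : ∀ a b : ℝ, Iio b \ Iio a = Ico a b := fun a b => by
    ext x; simp
  symm
  refine Measure.ext_of_Ico' _ _ (fun a b hab => ?_) fun a b hab => ?_
  · refine ne_top_of_le_ne_top ?_ (measure_mono (Ico_subset_Iio_self (a := a) (b := b)))
    rw [h2]
    exact ENNReal.ofReal_ne_top
  rw [← h3, measure_sdiff (Iio_subset_Iio hab.le) measurableSet_Iio.nullMeasurableSet,
    measure_sdiff (Iio_subset_Iio hab.le) measurableSet_Iio.nullMeasurableSet, h1, h1, h2, h2]
  · rw [h1]; exact ENNReal.ofReal_ne_top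
  · rw [h2]; exact ENNReal.ofReal_ne_top

lemma expMeasure_Ioi {r : ℝ} (hr : 0 < r) {x : ℝ} (hx : 0 ≤ x) :
    expMeasure r (Ioi x) = ENNReal.ofReal (Real.exp (-(r * x))) := by
  have := isProbabilityMeasure_expMeasure hr
  have h2 := cdf_expMeasure_eq hr x
  rw [cdf_eq_real, if_pos hx] at h2
  rw [← compl_Iic, prob_compl_eq_one_sub measurableSet_Iic,
    ← ENNReal.ofReal_toReal (measure_ne_top (expMeasure r) (Iic x)), ← ENNReal.ofReal_one,
    ← ENNReal.ofReal_sub _ ENNReal.toReal_nonneg]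
  rw [measureReal_def] at h2
  rw [h2]
  congr 1
  ring

lemma expMeasure_Ici {r : ℝ} (hr : 0 < r) {x : ℝ} (hx : 0 ≤ x) :
    expMeasure r (Ici x) = ENNReal.ofReal (Real.exp (-(r * x))) := by
  have hac : expMeasure r ≪ volume := withDensity_absolutelyContinuous _ _
  rw [← measure_congr (Ioi_ae_eq_Ici' (hac (by simp))), expMeasure_Ioi hr hx]

lemma lintegral_expMeasure (r : ℝ) {F : ℝ → ℝ≥0∞} (hF : Measurable F) :
    ∫⁻ z, F z ∂(expMeasure r) =
      ∫⁻ z in Ioi 0, ENNReal.ofReal (r * Real.exp (-(r * z))) * F z := by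
  have h : expMeasure r = volume.withDensity (exponentialPDF r) := rfl
  have hm : Measurable (exponentialPDF r) := (measurable_exponentialPDFReal r).ennreal_ofReal
  rw [h, lintegral_withDensity_eq_lintegral_mul _ hm hF,
    setLIntegral_congr (Ioi_ae_eq_Ici (a := (0 : ℝ))), ← lintegral_indicator measurableSet_Ici]
  refine lintegral_congr fun z => ?_
  by_cases hz : 0 ≤ z
  · rw [indicator_of_mem (by exact hz), Pi.mul_apply, exponentialPDF_of_nonneg hz]
  · rw [indicator_of_notMem (by exact hz), Pi.mul_apply, exponentialPDF_of_neg (not_le.1 hz),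
      zero_mul]

section Superposition

variable {Ω κ : Type*} [MeasurableSpace Ω] {μ : Measure Ω} [IsProbabilityMeasure μ]
  {num : κ → Ω → ℕ∞} {X : κ → ℕ → Ω → Plane} {lam : κ → ℝ}

lemma measure_le_nearestDist_eq_exp (hppp : ∀ k, IsHomogeneousPPP μ (num k) (X k) (lam k))
    (hind : iIndepFun (fun k ω => (num k ω, fun n => X k n ω)) μ) (hlam : ∀ k, 0 ≤ lam k)
    (U : Finset κ) (a : ℝ≥0) :
    μ {ω | (a : ℝ≥0∞) ≤ nearestDist num X U ω} =
      ENNReal.ofReal (Real.exp (-(Real.pi * (∑ k ∈ U, lam k) * (a : ℝ) ^ 2))) := by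
  rw [measure_le_nearestDist hppp hind hlam, volume_nnnorm_lt, ← Finset.sum_mul,
    ← ENNReal.ofReal_sum_of_nonneg fun k _ => hlam k,
    ← ENNReal.ofReal_mul (Finset.sum_nonneg fun k _ => hlam k), expNeg_ofReal]
  · congr 3; ring
  · exact mul_nonneg (Finset.sum_nonneg fun k _ => hlam k) (by positivity)

/-- The probability that the disk of radius n is empty tends to 0 when the total intensity is
positive. -/
lemma nearestDist_ne_top (hppp : ∀ k, IsHomogeneousPPP μ (num k) (X k) (lam k))
    (hind : iIndepFun (fun k ω => (num k ω, fun n => X k n ω)) μ) (hlam : ∀ k, 0 ≤ lam k)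
    {U : Finset κ} (hU : 0 < ∑ k ∈ U, lam k) : ∀ᵐ ω ∂μ, nearestDist num X U ω ≠ ∞ := by
  have h1 : ∀ n : ℕ, μ {ω | nearestDist num X U ω = ∞} ≤
      ENNReal.ofReal (Real.exp (-(Real.pi * (∑ k ∈ U, lam k) * (n : ℝ) ^ 2))) := fun n => by
    have := measure_le_nearestDist_eq_exp hppp hind hlam U (n : ℝ≥0)
    rw [NNReal.coe_natCast] at this
    rw [← this]
    refine measure_mono fun ω hω => ?_
    have hω' : nearestDist num X U ω = ∞ := hω
    simp [hω']
  have h2 : Tendsto (fun n : ℕ => ENNReal.ofReal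
      (Real.exp (-(Real.pi * (∑ k ∈ U, lam k) * (n : ℝ) ^ 2)))) atTop (𝓝 0) := by
    rw [← ENNReal.ofReal_zero]
    refine ENNReal.tendsto_ofReal (Real.tendsto_exp_neg_atTop_nhds_zero.comp ?_)
    exact Tendsto.const_mul_atTop (by positivity)
      ((tendsto_pow_atTop two_ne_zero).comp tendsto_natCast_atTop_atTop)
  rw [ae_iff]
  simp only [not_not]
  exact le_antisymm (ge_of_tendsto' h2 h1) zero_le

/-- The void probability exp(-πλa²) with a = √t is the exponential tail at t, and closed upper tails
determine a law. -/
lemma hasLaw_nearestDist_sq (hppp : ∀ k, IsHomogeneousPPP μ (num k) (X k) (lam k))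
    (hind : iIndepFun (fun k ω => (num k ω, fun n => X k n ω)) μ) (hlam : ∀ k, 0 ≤ lam k)
    {U : Finset κ} (hU : 0 < ∑ k ∈ U, lam k) :
    HasLaw (fun ω => (nearestDist num X U ω).toReal ^ 2)
      (expMeasure (Real.pi * ∑ k ∈ U, lam k)) μ := by
  have hDm : Measurable (nearestDist num X U) :=
    measurable_nearestDist (fun k => (hppp k).measurable_num) fun k => (hppp k).measurable_point
  have hm : Measurable fun ω => (nearestDist num X U ω).toReal ^ 2 := hDm.ennreal_toReal.pow_const 2
  refine ⟨hm.aemeasurable, ?_⟩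
  have hpos : 0 < Real.pi * ∑ k ∈ U, lam k := by positivity
  have := isProbabilityMeasure_expMeasure hpos
  have : IsProbabilityMeasure (μ.map fun ω => (nearestDist num X U ω).toReal ^ 2) :=
    Measure.isProbabilityMeasure_map hm.aemeasurable
  refine Measure.ext_of_Ici _ _ fun t => ?_
  have key : ∀ t : ℝ, 0 ≤ t → (μ.map fun ω => (nearestDist num X U ω).toReal ^ 2) (Ici t) =
      expMeasure (Real.pi * ∑ k ∈ U, lam k) (Ici t) := fun t ht => by
    rw [Measure.map_apply hm measurableSet_Ici, expMeasure_Ici hpos ht]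
    have h1 := measure_le_nearestDist_eq_exp hppp hind hlam U (√t).toNNReal
    rw [Real.coe_toNNReal _ (Real.sqrt_nonneg t), Real.sq_sqrt ht] at h1
    rw [← h1]
    refine measure_congr ?_
    filter_upwards [nearestDist_ne_top hppp hind hlam hU] with ω hω
    refine propext ?_
    change t ≤ (nearestDist num X U ω).toReal ^ 2 ↔ _ ≤ nearestDist num X U ω
    rw [← ENNReal.coe_toNNReal hω, ENNReal.coe_le_coe, ← NNReal.coe_le_coe,
      Real.coe_toNNReal _ (Real.sqrt_nonneg t),
      ENNReal.coe_toReal, Real.sqrt_le_left (NNReal.coe_nonneg _)]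
  rcases le_or_gt 0 t with ht | ht
  · exact key t ht
  · have h0 : expMeasure (Real.pi * ∑ k ∈ U, lam k) (Ici 0) = 1 := by
      rw [expMeasure_Ici hpos le_rfl]
      simp
    have h1 := key 0 le_rfl
    rw [h0] at h1
    have hsub : Ici (0 : ℝ) ⊆ Ici t := Ici_subset_Ici.2 ht.le
    rw [le_antisymm prob_le_one (h1 ▸ measure_mono hsub),
      le_antisymm prob_le_one (h0 ▸ measure_mono hsub)]

end Superposition

/-! ### The incomplete Gamma function and the radial integral -/

lemma integrableOn_upperGamma_integrand (s : ℝ) {x : ℝ} (hx : 0 < x) :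
    IntegrableOn (fun t : ℝ => t ^ (s - 1) * Real.exp (-t)) (Ioi x) := by
  refine integrable_of_isBigO_exp_neg (b := 1 / 2) (by norm_num) (fun t ht => ?_) ?_
  · have ht' : 0 < t := hx.trans_le ht
    exact ((Real.continuousAt_rpow_const t _ (Or.inl ht'.ne')).mul
      (by fun_prop)).continuousWithinAt
  · simpa only [mul_comm] using (Real.Gamma_integrand_isLittleO (s - 1)).isBigO

lemma hasDerivAt_upperGamma (s : ℝ) {x : ℝ} (hx : 0 < x) :
    HasDerivAt (upperGamma s) (-(x ^ (s - 1) * Real.exp (-x))) x := by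
  have hc : ∀ y : ℝ, 0 < y → ContinuousAt (fun t : ℝ => t ^ (s - 1) * Real.exp (-t)) y :=
    fun y hy => (Real.continuousAt_rpow_const y _ (Or.inl hy.ne')).mul (by fun_prop)
  have hx2 : 0 < x / 2 := by positivity
  have h1 : HasDerivAt (fun y => ∫ t in (x / 2)..y, t ^ (s - 1) * Real.exp (-t))
      (x ^ (s - 1) * Real.exp (-x)) x := by
    refine intervalIntegral.integral_hasDerivAt_right ?_ ?_ (hc x hx)
    · refine ContinuousOn.intervalIntegrable fun y hy => (hc y ?_).continuousWithinAt
      rw [uIcc_of_le (by linarith)] at hy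
      exact hx2.trans_le hy.1
    · exact ContinuousOn.stronglyMeasurableAtFilter isOpen_Ioi
        (fun y hy => (hc y hy).continuousWithinAt) x (mem_Ioi.2 hx)
  refine (h1.const_sub (upperGamma s (x / 2))).congr_of_eventuallyEq ?_
  filter_upwards [lt_mem_nhds hx] with y hy
  rw [upperGamma, upperGamma, ← intervalIntegral.integral_interval_add_Ioi
    (integrableOn_upperGamma_integrand s hx2) (integrableOn_upperGamma_integrand s hy)]
  ring

/-- Integration by parts. It trades the index -a, for which the integral blows up as x tends to 0,
for 1 - a, which is harmless there when a < 1. -/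
lemma upperGamma_neg {a x : ℝ} (ha : 0 < a) (hx : 0 < x) :
    upperGamma (-a) x = (Real.exp (-x) * x ^ (-a) - upperGamma (1 - a) x) / a := by
  have h1 := integrableOn_upperGamma_integrand (-a) hx
  have h2 := integrableOn_upperGamma_integrand (1 - a) hx
  have hderiv : ∀ t ∈ Ici x, HasDerivAt (fun t : ℝ => -(Real.exp (-t) * t ^ (-a)))
      (a * (t ^ (-a - 1) * Real.exp (-t)) + t ^ (1 - a - 1) * Real.exp (-t)) t := fun t ht => by
    have ht' : t ≠ 0 := (hx.trans_le ht).ne'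
    have := ((hasDerivAt_neg t).exp.mul (Real.hasDerivAt_rpow_const (p := -a) (Or.inl ht'))).neg
    refine this.congr_deriv ?_
    rw [show 1 - a - 1 = -a by ring]
    ring
  have hlim : Tendsto (fun t : ℝ => -(Real.exp (-t) * t ^ (-a))) atTop (𝓝 0) := by
    have := (Real.tendsto_exp_neg_atTop_nhds_zero.mul (tendsto_rpow_neg_atTop ha)).neg
    simpa using this
  have h3 := integral_Ioi_of_hasDerivAt_of_tendsto' hderiv ((h1.const_mul a).add h2) hlim
  rw [integral_add (h1.const_mul a) h2, integral_const_mul] at h3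
  rw [eq_div_iff ha.ne', upperGamma, upperGamma]
  linarith

lemma tendsto_upperGamma_zero {s : ℝ} (hs : 0 < s) :
    Tendsto (upperGamma s) (𝓝[>] 0) (𝓝 (Real.Gamma s)) := by
  have hint : IntegrableOn (fun t : ℝ => t ^ (s - 1) * Real.exp (-t)) (Ioi 0) := by
    simpa only [mul_comm] using Real.GammaIntegral_convergent hs
  have h : Tendsto (fun x => ∫ t in Ioi 0, (Ioi x).indicator
      (fun t : ℝ => t ^ (s - 1) * Real.exp (-t)) t) (𝓝[>] 0)
      (𝓝 (∫ t in Ioi 0, t ^ (s - 1) * Real.exp (-t))) := by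
    refine tendsto_integral_filter_of_dominated_convergence
      (fun t => ‖t ^ (s - 1) * Real.exp (-t)‖) ?_ ?_ hint.norm ?_
    · exact .of_forall fun x => hint.aestronglyMeasurable.indicator measurableSet_Ioi
    · exact .of_forall fun x => .of_forall fun t => norm_indicator_le_norm_self _ _
    · refine (ae_restrict_iff' measurableSet_Ioi).2 (.of_forall fun t ht => ?_)
      refine tendsto_const_nhds.congr' ?_
      filter_upwards [nhdsWithin_le_nhds (gt_mem_nhds ht)] with x hx
      rw [indicator_of_mem (by exact hx)]
  rw [Real.Gamma_eq_integral hs]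
  simp_rw [mul_comm (Real.exp _)]
  refine h.congr' ?_
  filter_upwards [self_mem_nhdsWithin] with x hx
  rw [integral_indicator measurableSet_Ioi, Measure.restrict_restrict measurableSet_Ioi,
    inter_eq_left.2 (Ioi_subset_Ioi (le_of_lt hx)), upperGamma]

/-- The closed form of the exponent of the Laplace transform of the interference, for a fixed
gain. -/
lemma integral_one_sub_exp_neg_rpow {a c : ℝ} (ha : 0 < a) (ha1 : a < 1) (hc : 0 < c) :
    IntegrableOn (fun u : ℝ => 1 - Real.exp (-(c * u ^ (-(1 / a))))) (Ioi 1) ∧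
    ∫ u in Ioi (1 : ℝ), (1 - Real.exp (-(c * u ^ (-(1 / a))))) =
      a * c ^ a * (upperGamma (-a) c - Real.Gamma (-a)) - 1 := by
  -- The antiderivative comes from the substitution t = c u^(-1/a), under which e^(-t) du is a
  -- multiple of t^(-a-1) e^(-t) dt.
  set F : ℝ → ℝ := fun u => u - a * c ^ a * upperGamma (-a) (c * u ^ (-(1 / a))) with hF
  have hderiv : ∀ u ∈ Ici (1 : ℝ), HasDerivAt F (1 - Real.exp (-(c * u ^ (-(1 / a))))) u :=
    fun u hu => by
    have hu0 : 0 < u := zero_lt_one.trans_le hu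
    have hx : 0 < c * u ^ (-(1 / a)) := by positivity
    have h1 := (Real.hasDerivAt_rpow_const (p := -(1 / a)) (Or.inl hu0.ne')).const_mul c
    have h2 := (hasDerivAt_id u).sub
      (((hasDerivAt_upperGamma (-a) hx).comp u h1).const_mul (a * c ^ a))
    refine HasDerivAt.congr_deriv (f := F) h2 ?_
    have e1 : (c * u ^ (-(1 / a))) ^ (-a - 1) = c ^ (-a - 1) * u ^ (1 + 1 / a) := by
      rw [Real.mul_rpow hc.le (by positivity), ← Real.rpow_mul hu0.le]
      congr 2
      field_simp
      ring
    have e2 : c ^ a * (c ^ (-a - 1) * c) = 1 := by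
      rw [← Real.rpow_add_one hc.ne', ← Real.rpow_add hc]
      simp
    have e3 : u ^ (1 + 1 / a) * u ^ (-(1 / a) - 1) = 1 := by
      rw [← Real.rpow_add hu0, show 1 + 1 / a + (-(1 / a) - 1) = 0 by ring, Real.rpow_zero]
    have e4 : a * c ^ a * (-((c * u ^ (-(1 / a))) ^ (-a - 1) *
        Real.exp (-(c * u ^ (-(1 / a))))) * (c * (-(1 / a) * u ^ (-(1 / a) - 1)))) =
        (a * (1 / a)) * (c ^ a * (c ^ (-a - 1) * c)) * (u ^ (1 + 1 / a) * u ^ (-(1 / a) - 1)) *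
        Real.exp (-(c * u ^ (-(1 / a)))) := by
      rw [e1]; ring
    rw [e4, e2, e3, mul_one_div_cancel ha.ne']
    ring
  have hpos : ∀ u ∈ Ioi (1 : ℝ), 0 ≤ 1 - Real.exp (-(c * u ^ (-(1 / a)))) := fun u hu => by
    have hu0 : 0 < u := zero_lt_one.trans hu
    rw [sub_nonneg, Real.exp_le_one_iff, neg_nonpos]
    positivity
  have hx0 : Tendsto (fun u : ℝ => c * u ^ (-(1 / a))) atTop (𝓝[>] 0) := by
    refine tendsto_nhdsWithin_iff.2 ⟨?_, ?_⟩
    · simpa using (tendsto_rpow_neg_atTop (y := 1 / a) (by positivity)).const_mul c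
    · filter_upwards [eventually_gt_atTop 0] with u hu
      exact mem_Ioi.2 (by positivity)
  -- The two terms of `F` diverge separately. By `upperGamma_neg`, `F` equals u(1 - e^(-t)) + c^a
  -- Γ(1-a, t) with t = c u^(-1/a). The first term is at most c u^(1-1/a), which vanishes because a
  -- < 1; the second tends to c^a Γ(1-a) = -a c^a Γ(-a), where Γ(-a) is the continued Gamma
  -- function.
  have hlim : Tendsto F atTop (𝓝 (-(a * c ^ a * Real.Gamma (-a)))) := by
    have hG : Real.Gamma (1 - a) = -a * Real.Gamma (-a) := by
      rw [← Real.Gamma_add_one (neg_ne_zero.2 ha.ne')]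
      congr 1; ring
    have h1 : Tendsto (fun u : ℝ => c ^ a * upperGamma (1 - a) (c * u ^ (-(1 / a)))) atTop
        (𝓝 (c ^ a * Real.Gamma (1 - a))) :=
      ((tendsto_upperGamma_zero (by linarith)).comp hx0).const_mul _
    have h2 : Tendsto (fun u : ℝ => u * (1 - Real.exp (-(c * u ^ (-(1 / a)))))) atTop (𝓝 0) := by
      have h3 : Tendsto (fun u : ℝ => c * u ^ (-(1 / a - 1))) atTop (𝓝 0) := by
        have : 0 < 1 / a - 1 := by
          rw [sub_pos, lt_div_iff₀ ha]; linarith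
        simpa using (tendsto_rpow_neg_atTop this).const_mul c
      refine tendsto_of_tendsto_of_tendsto_of_le_of_le' tendsto_const_nhds h3 ?_ ?_
      · filter_upwards [eventually_gt_atTop 1] with u hu
        exact mul_nonneg (by linarith) (hpos u hu)
      · filter_upwards [eventually_gt_atTop 0] with u hu
        have e : c * u ^ (-(1 / a - 1)) = u * (c * u ^ (-(1 / a))) := by
          rw [show -(1 / a - 1) = -(1 / a) + 1 by ring, Real.rpow_add_one hu.ne']; ring
        rw [e]
        gcongr
        have := Real.add_one_le_exp (-(c * u ^ (-(1 / a))))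
        linarith
    have h3 := h2.add h1
    rw [hG, show 0 + c ^ a * (-a * Real.Gamma (-a)) = -(a * c ^ a * Real.Gamma (-a)) by ring] at h3
    refine h3.congr' ?_
    filter_upwards [eventually_gt_atTop 0] with u hu
    have hx : 0 < c * u ^ (-(1 / a)) := by positivity
    have e : c ^ a * (c * u ^ (-(1 / a))) ^ (-a) = u := by
      rw [Real.mul_rpow hc.le (by positivity), ← Real.rpow_mul hu.le, ← mul_assoc,
        ← Real.rpow_add hc]
      have : -(1 / a) * -a = 1 := by field_simp
      rw [this, add_neg_cancel, Real.rpow_zero, Real.rpow_one, one_mul]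
    simp only [hF]
    rw [upperGamma_neg ha hx]
    have : a * c ^ a * ((Real.exp (-(c * u ^ (-(1 / a)))) * (c * u ^ (-(1 / a))) ^ (-a) -
        upperGamma (1 - a) (c * u ^ (-(1 / a)))) / a) =
        Real.exp (-(c * u ^ (-(1 / a)))) * (c ^ a * (c * u ^ (-(1 / a))) ^ (-a)) -
        c ^ a * upperGamma (1 - a) (c * u ^ (-(1 / a))) := by
      field_simp
    rw [this, e]
    ring
  refine ⟨integrableOn_Ioi_deriv_of_nonneg' hderiv hpos hlim, ?_⟩
  rw [integral_Ioi_of_hasDerivAt_of_nonneg' hderiv hpos hlim]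
  simp only [hF, Real.one_rpow, mul_one]
  ring

/-- The expected mass removed by the interference of one unit of intensity, around a disk of
radius `r`. -/
lemma lintegral_one_sub_expNeg_beyond {α c r : ℝ} (hα : 2 < α) (hc : 0 < c) (hr : 0 < r) :
    ∫⁻ x : Plane, (if ‖x‖ ≤ r then 0 else ENNReal.ofReal (1 - Real.exp (-(c * (r / ‖x‖) ^ α)))) =
      ENNReal.ofReal (Real.pi * r ^ 2) * ENNReal.ofReal
        (2 / α * c ^ (2 / α) * (upperGamma (-(2 / α)) c - Real.Gamma (-(2 / α))) - 1) := by
  -- In the variable u = ‖x‖²/r² the factor (r/‖x‖)^α is u^(-α/2), so the radial integral has index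
  -- a = 2/α, and α > 2 is what gives a < 1.
  set h : ℝ → ℝ≥0∞ := (Ioi 1).indicator fun u =>
    ENNReal.ofReal (1 - Real.exp (-(c * u ^ (-(1 / (2 / α)))))) with hh
  have hm : Measurable h := by
    refine Measurable.indicator ?_ measurableSet_Ioi
    fun_prop
  have h1 : ∀ x : Plane, (if ‖x‖ ≤ r then 0 else
      ENNReal.ofReal (1 - Real.exp (-(c * (r / ‖x‖) ^ α)))) = h (‖x‖ ^ 2 / r ^ 2) := fun x => by
    by_cases hx : ‖x‖ ≤ r
    · rw [if_pos hx, hh, indicator_of_notMem]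
      rw [mem_Ioi, not_lt, div_le_one (by positivity)]
      gcongr
    · rw [if_neg hx, hh, indicator_of_mem]
      · congr 5
        have hx' : 0 < ‖x‖ := hr.trans (not_le.1 hx)
        rw [← div_pow, ← Real.rpow_natCast, ← Real.rpow_mul (by positivity),
          ← inv_div, Real.inv_rpow (by positivity), ← Real.rpow_neg (by positivity)]
        congr 1
        push_cast
        field_simp
      · rw [mem_Ioi, one_lt_div (by positivity)]
        gcongr
        exact not_le.1 hx
  simp_rw [h1]
  rw [← lintegral_map hm (by fun_prop), map_norm_sq_div_volume hr, lintegral_smul_measure, hh,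
    lintegral_indicator measurableSet_Ioi, Measure.restrict_restrict measurableSet_Ioi,
    inter_eq_left.2 (Ioi_subset_Ioi zero_le_one), smul_eq_mul]
  obtain ⟨hi, he⟩ := integral_one_sub_exp_neg_rpow (a := 2 / α) (by positivity)
    ((div_lt_one (by linarith)).2 hα) hc
  rw [← ofReal_integral_eq_lintegral_ofReal hi, he]
  refine (ae_restrict_iff' measurableSet_Ioi).2 (.of_forall fun u hu => ?_)
  have hu0 : 0 < u := zero_lt_one.trans hu
  rw [Pi.zero_apply, sub_nonneg, Real.exp_le_one_iff, neg_nonpos]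
  positivity

/-! ### Loss caused by an interferer, and the constant β -/

/-- The expected loss `E[1 - exp (-(T g / p) (r / ‖x‖)^α)]` caused by an active interferer at `x`,
when the serving BS has distance `r`. -/
noncomputable def interferenceLoss (T p α : ℝ) (ν : Measure ℝ) (r : ℝ≥0) (x : Plane) : ℝ≥0∞ :=
  ∫⁻ g, ENNReal.ofReal (1 - Real.exp (-(T * g / p * ((r : ℝ) / ‖x‖) ^ α))) ∂ν

section InterferenceLoss

variable {T p α : ℝ} {ν : Measure ℝ}

lemma interferenceLoss_le_one [IsProbabilityMeasure ν] (r : ℝ≥0) (x : Plane) :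
    interferenceLoss T p α ν r x ≤ 1 := by
  calc interferenceLoss T p α ν r x ≤ ∫⁻ _, 1 ∂ν := by
        refine lintegral_mono fun g => ENNReal.ofReal_le_one.2 ?_
        linarith [Real.exp_pos (-(T * g / p * ((r : ℝ) / ‖x‖) ^ α))]
    _ = 1 := by simp

lemma measurable_interferenceLoss [SFinite ν] (r : ℝ≥0) :
    Measurable (interferenceLoss T p α ν r) := by
  refine Measurable.lintegral_prod_right' (f := fun z : Plane × ℝ =>
    ENNReal.ofReal (1 - Real.exp (-(T * z.2 / p * ((r : ℝ) / ‖z.1‖) ^ α)))) ?_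
  fun_prop

/-- With continuity in r, this is what the dyadic limit requires of the weights. Positive gains make
the exponent increase with r. -/
lemma monotone_interferenceLoss (hT : 0 < T) (hp : 0 < p) (hα : 2 < α)
    (hν : ∀ᵐ g ∂ν, 0 < g) (x : Plane) : Monotone fun r => interferenceLoss T p α ν r x := by
  intro r r' h
  refine lintegral_mono_ae ?_
  filter_upwards [hν] with g hg
  have : (r : ℝ) ≤ r' := h
  have : 0 ≤ T * g / p := by positivity
  gcongr

lemma continuous_interferenceLoss [IsProbabilityMeasure ν] (hα : 2 < α) (x : Plane) :
    Continuous fun r => interferenceLoss T p α ν r x := by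
  refine continuous_iff_continuousAt.2 fun r => ?_
  refine tendsto_lintegral_filter_of_dominated_convergence (fun _ => 1) ?_ ?_ (by simp) ?_
  · exact .of_forall fun r => by fun_prop
  · refine .of_forall fun r => .of_forall fun g => ENNReal.ofReal_le_one.2 ?_
    linarith [Real.exp_pos (-(T * g / p * ((r : ℝ) / ‖x‖) ^ α))]
  · refine .of_forall fun g => Continuous.tendsto ?_ r
    refine ENNReal.continuous_ofReal.comp (continuous_const.sub (Real.continuous_exp.comp
      (Continuous.neg (continuous_const.mul ?_))))
    exact (NNReal.continuous_coe.div_const _).rpow_const fun _ => Or.inr (by linarith)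

end InterferenceLoss

section Beta

variable {T p α : ℝ} {ν : Measure ℝ}

lemma betaTerm_eq (hT : 0 < T) (hp : 0 < p) {g : ℝ} (hg : 0 < g) :
    2 / α * (T * g / p) ^ (2 / α) *
      (upperGamma (-(2 / α)) (T * g / p) - Real.Gamma (-(2 / α))) =
    2 * (T / p) ^ (2 / α) / α * betaTerm T p α g := by
  rw [betaTerm, show T * g / p = T / p * g by ring, Real.mul_rpow (by positivity) hg.le]
  ring

/-- The difference of the two sides is the radial integral of a nonnegative function. Averaged over
g this gives β ≥ 1, hence A₂ > 0. -/
lemma one_le_mul_betaTerm (hα : 2 < α) (hT : 0 < T) (hp : 0 < p) {g : ℝ} (hg : 0 < g) :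
    1 ≤ 2 * (T / p) ^ (2 / α) / α * betaTerm T p α g := by
  have h := (integral_one_sub_exp_neg_rpow (a := 2 / α) (c := T * g / p) (by positivity)
    ((div_lt_one (by linarith)).2 hα) (by positivity)).2
  rw [betaTerm_eq hT hp hg] at h
  rw [← sub_nonneg, ← h]
  refine setIntegral_nonneg measurableSet_Ioi fun u hu => ?_
  have hu0 : 0 < u := zero_lt_one.trans hu
  rw [sub_nonneg, Real.exp_le_one_iff, neg_nonpos]
  positivity

lemma betaConst_sub_one [IsProbabilityMeasure ν] (hβ : Integrable (betaTerm T p α) ν) :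
    betaConst T p α ν - 1 =
      ∫ g, (2 * (T / p) ^ (2 / α) / α * betaTerm T p α g - 1) ∂ν := by
  rw [integral_sub (hβ.const_mul _) (integrable_const _), integral_const_mul, betaConst]
  simp

lemma one_le_betaConst [IsProbabilityMeasure ν] (hα : 2 < α) (hT : 0 < T) (hp : 0 < p)
    (hν : ∀ᵐ g ∂ν, 0 < g) (hβ : Integrable (betaTerm T p α) ν) : 1 ≤ betaConst T p α ν := by
  rw [← sub_nonneg, betaConst_sub_one hβ]
  refine integral_nonneg_of_ae ?_
  filter_upwards [hν] with g hg
  exact sub_nonneg.2 (one_le_mul_betaTerm hα hT hp hg)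

/-- Tonelli exchanges the area integral with the expectation over the gain, so the fixed-gain
formula can be averaged into β - 1. -/
lemma lintegral_interferenceLoss [IsProbabilityMeasure ν] (hα : 2 < α) (hT : 0 < T) (hp : 0 < p)
    (hν : ∀ᵐ g ∂ν, 0 < g) (hβ : Integrable (betaTerm T p α) ν) {r : ℝ≥0} (hr : 0 < r) :
    ∫⁻ x : Plane, (if ‖x‖₊ ≤ r then 0 else interferenceLoss T p α ν r x) =
      ENNReal.ofReal (Real.pi * (r : ℝ) ^ 2 * (betaConst T p α ν - 1)) := by
  have h1 : ∀ x : Plane, (if ‖x‖₊ ≤ r then 0 else interferenceLoss T p α ν r x) =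
      ∫⁻ g, (if ‖x‖ ≤ r then 0 else
        ENNReal.ofReal (1 - Real.exp (-(T * g / p * ((r : ℝ) / ‖x‖) ^ α)))) ∂ν := fun x => by
    have : ‖x‖₊ ≤ r ↔ ‖x‖ ≤ r := by rw [← NNReal.coe_le_coe, coe_nnnorm]
    simp only [this]
    split_ifs
    · simp
    · rfl
  simp_rw [h1]
  rw [lintegral_lintegral_swap]
  · have h2 : ∀ᵐ g ∂ν, ∫⁻ x : Plane, (if ‖x‖ ≤ r then 0 else
        ENNReal.ofReal (1 - Real.exp (-(T * g / p * ((r : ℝ) / ‖x‖) ^ α)))) =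
        ENNReal.ofReal (Real.pi * (r : ℝ) ^ 2) *
          ENNReal.ofReal (2 * (T / p) ^ (2 / α) / α * betaTerm T p α g - 1) := by
      filter_upwards [hν] with g hg
      rw [lintegral_one_sub_expNeg_beyond hα (by positivity) (by exact_mod_cast hr),
        betaTerm_eq hT hp hg]
    rw [lintegral_congr_ae h2, lintegral_const_mul' _ _ ENNReal.ofReal_ne_top,
      ← ofReal_integral_eq_lintegral_ofReal
        (f := fun g => 2 * (T / p) ^ (2 / α) / α * betaTerm T p α g - 1)
        ((hβ.const_mul _).sub (integrable_const _)),
      ← betaConst_sub_one hβ, ← ENNReal.ofReal_mul (by positivity)]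
    filter_upwards [hν] with g hg
    exact sub_nonneg.2 (one_le_mul_betaTerm hα hT hp hg)
  · refine Measurable.aemeasurable ?_
    refine Measurable.ite (measurableSet_le (by fun_prop) measurable_const) measurable_const ?_
    fun_prop

end Beta

/-! ### The SINR in terms of configuration, marks and signal -/

namespace CellularNetwork

variable {K : ℕ} {Ω : Type*}

lemma servingDist_eq (N : CellularNetwork K Ω) (S : Finset (Fin (K + 1))) (ω : Ω) :
    N.servingDist S ω = (nearestDist N.num N.loc (insert 0 S) ω).toReal := by
  set D := nearestDist N.num N.loc (insert 0 S) ω with hD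
  rcases (N.sharedBS S ω).eq_empty_or_nonempty with he | hne
  -- Without any BS both sides are default values: the infimum of the empty set is 0, and so is
  -- `∞.toReal`.
  · have : D = ∞ := by
      rw [eq_top_iff, hD, le_nearestDist_iff]
      intro k hk n hn
      have : (k, n) ∈ N.sharedBS S ω := ⟨hk, hn⟩
      simp [he] at this
    rw [servingDist, he, this]
    simp
  · have hDle : ∀ i ∈ N.sharedBS S ω, D ≤ (‖N.pos i ω‖₊ : ℝ≥0∞) := fun i hi =>
      le_nearestDist_iff.1 le_rfl i.1 hi.1 i.2 hi.2
    obtain ⟨j, hj⟩ := hne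
    have hDtop : D ≠ ∞ := ne_top_of_le_ne_top ENNReal.coe_ne_top (hDle j hj)
    have hbdd : BddBelow ((fun i => ‖N.pos i ω‖) '' N.sharedBS S ω) :=
      ⟨0, by rintro _ ⟨i, -, rfl⟩; exact norm_nonneg _⟩
    refine le_antisymm ?_ (le_csInf ⟨_, mem_image_of_mem _ hj⟩ ?_)
    · rw [← ENNReal.ofReal_le_iff_le_toReal hDtop, hD, le_nearestDist_iff]
      intro k hk n hn
      rw [← enorm_eq_nnnorm, ← ofReal_norm]
      exact ENNReal.ofReal_le_ofReal (csInf_le hbdd ⟨(k, n), ⟨hk, hn⟩, rfl⟩)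
    · rintro _ ⟨i, hi, rfl⟩
      simpa using ENNReal.toReal_mono ENNReal.coe_ne_top (hDle i hi)

lemma isServing_iff (N : CellularNetwork K Ω) (S : Finset (Fin (K + 1))) (ω : Ω)
    (i : Fin (K + 1) × ℕ) : N.IsServing S ω i ↔
      i ∈ N.sharedBS S ω ∧ (‖N.pos i ω‖₊ : ℝ≥0∞) ≤ nearestDist N.num N.loc (insert 0 S) ω := by
  rw [IsServing, le_nearestDist_iff]
  refine and_congr_right fun _ => ⟨fun h k hk n hn => ?_, fun h j hj => ?_⟩
  · exact ENNReal.coe_le_coe.2 (h (k, n) ⟨hk, hn⟩)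
  · exact ENNReal.coe_le_coe.1 (h j.1 hj.1 j.2 hj.2)

/-- The distance to the nearest BS of `U`, as a function of the BS configuration. -/
noncomputable def configDist (U : Finset (Fin (K + 1)))
    (c : Fin (K + 1) → ℕ∞ × (ℕ → Plane)) : ℝ≥0∞ :=
  nearestDist (fun k c => (c k).1) (fun k n c => (c k).2 n) U c

/-- The interference, as a function of the BS configuration and the marks. -/
noncomputable def configInterference (U : Finset (Fin (K + 1))) (p α : ℝ)
    (c : Fin (K + 1) → ℕ∞ × (ℕ → Plane)) (m : Fin (K + 1) × ℕ → ℝ × Bool) : ℝ≥0∞ :=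
  ∑' i : Fin (K + 1) × ℕ,
    if i.1 ∈ U ∧ (i.2 : ℕ∞) < (c i.1).1 ∧ (configDist U c).toNNReal < ‖(c i.1).2 i.2‖₊ then
      ENNReal.ofReal (((m i).2.toNat : ℝ) * (m i).1 * ‖(c i.1).2 i.2‖ ^ (-α) * p)
    else 0

/-- Non-serving BSs are exactly those strictly farther than the nearest distance, even if there are
ties. Finiteness excludes the default value of `toNNReal` at ∞. -/
lemma interference_eq (N : CellularNetwork K Ω) (S : Finset (Fin (K + 1))) (p α : ℝ) {ω : Ω}
    (h : nearestDist N.num N.loc (insert 0 S) ω ≠ ∞) :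
    N.interference S p α ω = configInterference (insert 0 S) p α
      (fun k => (N.num k ω, fun n => N.loc k n ω)) (fun i => (N.gain i ω, N.active i ω)) := by
  classical
  have hc : configDist (insert 0 S) (fun k => (N.num k ω, fun n => N.loc k n ω)) =
      nearestDist N.num N.loc (insert 0 S) ω := rfl
  rw [interference, configInterference, hc]
  refine (tsum_subtype {i | i ∈ N.sharedBS S ω ∧ ¬ N.IsServing S ω i} fun i =>
    ENNReal.ofReal (((N.active i ω).toNat : ℝ) * N.gain i ω * ‖N.pos i ω‖ ^ (-α) * p)).trans ?_
  refine tsum_congr fun i => ?_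
  rw [indicator_apply]
  refine if_congr ?_ rfl rfl
  change i ∈ N.sharedBS S ω ∧ ¬ N.IsServing S ω i ↔ _
  rw [isServing_iff, not_and, not_le, sharedBS]
  rw [← ENNReal.coe_lt_coe, ENNReal.coe_toNNReal h]
  constructor
  · rintro ⟨h1, h2⟩
    exact ⟨h1.1, h1.2, h2 h1⟩
  · rintro ⟨h1, h2, h3⟩
    exact ⟨⟨h1, h2⟩, fun _ => h3⟩

lemma measurable_configDist (U : Finset (Fin (K + 1))) : Measurable (configDist (K := K) U) :=
  measurable_nearestDist (fun k => by fun_prop) fun k n => by fun_prop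

lemma measurable_configInterference (U : Finset (Fin (K + 1))) (p α : ℝ) :
    Measurable (Function.uncurry (configInterference (K := K) U p α)) := by
  refine Measurable.tsum fun i => ?_
  have hpos : Measurable fun z : (Fin (K + 1) → ℕ∞ × (ℕ → Plane)) ×
      (Fin (K + 1) × ℕ → ℝ × Bool) => (z.1 i.1).2 i.2 := by fun_prop
  have hD : Measurable fun z : (Fin (K + 1) → ℕ∞ × (ℕ → Plane)) ×
      (Fin (K + 1) × ℕ → ℝ × Bool) => (configDist U z.1).toNNReal :=
    ((measurable_configDist U).comp measurable_fst).ennreal_toNNReal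
  have hnum : Measurable fun z : (Fin (K + 1) → ℕ∞ × (ℕ → Plane)) ×
      (Fin (K + 1) × ℕ → ℝ × Bool) => (z.1 i.1).1 := by fun_prop
  have hact : Measurable fun z : (Fin (K + 1) → ℕ∞ × (ℕ → Plane)) ×
      (Fin (K + 1) × ℕ → ℝ × Bool) => (((z.2 i).2.toNat : ℕ) : ℝ) :=
    (Measurable.of_discrete (f := fun b : Bool => ((b.toNat : ℕ) : ℝ))).comp (by fun_prop)
  refine Measurable.ite ((MeasurableSet.const _).inter
    ((hnum (MeasurableSet.of_discrete (s := Ioi (i.2 : ℕ∞)))).inter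
      (?_))) ?_ measurable_const
  · exact measurableSet_lt hD.coe_nnreal_real hpos.nnnorm.coe_nnreal_real
  exact (((hact.mul (by fun_prop)).mul (hpos.norm.pow_const _)).mul_const p).ennreal_ofReal

/-- Clearing the denominator stays valid when it is 0: a positive signal then has ratio ∞, and 0/0
is 0, as the strict inequality demands. -/
lemma lt_sinr_iff (N : CellularNetwork K Ω) (S : Finset (Fin (K + 1))) (p α s : ℝ) {T : ℝ}
    (hT : 0 < T) (ω : Ω) :
    ENNReal.ofReal T < N.sinr S p α s ω ↔
      ENNReal.ofReal T * (N.interference S p α ω + ENNReal.ofReal s) <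
        ENNReal.ofReal (N.signalGain ω * N.servingDist S ω ^ (-α) * p) := by
  rw [sinr]
  set J := N.interference S p α ω + ENNReal.ofReal s
  set x := N.signalGain ω * N.servingDist S ω ^ (-α) * p
  rcases eq_or_ne J 0 with hJ | hJ
  · rw [hJ, mul_zero]
    rcases eq_or_ne (ENNReal.ofReal x) 0 with hx | hx
    · simp [hx]
    · rw [ENNReal.div_zero hx]
      simp [pos_iff_ne_zero.2 hx]
  · exact ENNReal.lt_div_iff_mul_lt (Or.inl hJ) (Or.inr (by simpa using hT))

end CellularNetwork

/-! ### Averaging over fading and activity; the coverage probability -/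

namespace CellularNetwork.IsModel

variable {K : ℕ} {Ω : Type*} [MeasurableSpace Ω] {μ : Measure Ω}
  {S : Finset (Fin (K + 1))} {lam w : Fin (K + 1) → ℝ} {α p T : ℝ} {ν : Measure ℝ}
  {N : CellularNetwork K Ω}

lemma isProbabilityMeasure_gain [IsProbabilityMeasure μ] (hN : N.IsModel μ S lam w p ν) : IsProbabilityMeasure ν := by
  rw [← (hN.gain_law (0, 0)).map_eq]
  exact Measure.isProbabilityMeasure_map (hN.gain_law (0, 0)).aemeasurable

lemma activity_le_one [IsProbabilityMeasure μ] (hN : N.IsModel μ S lam w p ν)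
    {k : Fin (K + 1)} (hk : k ∈ insert 0 S) :
    ENNReal.ofReal (w k) ≤ 1 := by
  rw [← hN.active_law (k, 0) hk]
  exact prob_le_one

/-- Fading of the message signal: `Pr(p g > y) = exp (-y / p)`. -/
lemma measure_lt_signal (hN : N.IsModel μ S lam w p ν) (hp : 0 < p) {R : ℝ} (hR : 0 < R)
    (J : ℝ≥0∞) :
    μ {ω | J < ENNReal.ofReal (N.signalGain ω * R ^ (-α) * p)} =
      expNeg (ENNReal.ofReal (R ^ α / p) * J) := by
  have hc : 0 < R ^ α / p := by positivity
  induction J with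
  | top => simp [ENNReal.mul_top, hc]
  | coe y =>
    have h1 : {ω | (y : ℝ≥0∞) < ENNReal.ofReal (N.signalGain ω * R ^ (-α) * p)} =
        {ω | R ^ α * y < p * N.signalGain ω} := by
      ext ω
      rw [mem_ofPred_eq, mem_ofPred_eq, ← ENNReal.ofReal_coe_nnreal,
        ENNReal.ofReal_lt_ofReal_iff_of_nonneg y.coe_nonneg, Real.rpow_neg hR.le,
        show N.signalGain ω * (R ^ α)⁻¹ * p = p * N.signalGain ω / R ^ α by ring,
        lt_div_iff₀ (by positivity), mul_comm]
    have h2 := hN.signal_law.measure_eq (p := fun x => R ^ α * y < x) measurableSet_Ioi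
    rw [h1, h2]
    change expMeasure (1 / p) (Ioi (R ^ α * y)) = _
    rw [expMeasure_Ioi (by positivity) (by positivity), ← ENNReal.ofReal_coe_nnreal (p := y),
      ← ENNReal.ofReal_mul hc.le, expNeg_ofReal (by positivity)]
    congr 2
    ring

/-- The Laplace transform of the power received from one interferer. -/
lemma lintegral_expNeg_interferer [IsProbabilityMeasure μ] (hN : N.IsModel μ S lam w p ν)
    (hp : 0 < p) (hT : 0 < T)
    (hν : ∀ᵐ g ∂ν, 0 < g) {i : Fin (K + 1) × ℕ} (hi : i.1 ∈ insert 0 S) {R : ℝ≥0} (hR : 0 < R)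
    {x : Plane} (hx : R < ‖x‖₊) :
    ∫⁻ ω, expNeg (ENNReal.ofReal ((R : ℝ) ^ α / p) * (ENNReal.ofReal T * ENNReal.ofReal
        (((N.active i ω).toNat : ℝ) * N.gain i ω * ‖x‖ ^ (-α) * p))) ∂μ =
      1 - ENNReal.ofReal (w i.1) * interferenceLoss T p α ν R x := by
  have hR' : (0 : ℝ) < R := by exact_mod_cast hR
  have hx' : (0 : ℝ) < ‖x‖ := by
    have : (R : ℝ) < ‖x‖ := by exact_mod_cast hx
    exact hR'.trans this
  have hgm := hN.measurable_gain i
  have ham := hN.measurable_active i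
  set G : Ω → ℝ≥0∞ := fun ω => expNeg (ENNReal.ofReal ((R : ℝ) ^ α / p) * (ENNReal.ofReal T *
    ENNReal.ofReal (((N.active i ω).toNat : ℝ) * N.gain i ω * ‖x‖ ^ (-α) * p))) with hG
  set H : ℝ → ℝ≥0∞ := fun g => ENNReal.ofReal (1 - Real.exp (-(T * g / p * ((R : ℝ) / ‖x‖) ^ α)))
    with hH
  have hHm : Measurable H := by fun_prop
  set b : Bool → ℝ≥0∞ := fun a => if a then 1 else 0 with hb
  have hbm : Measurable b := .of_discrete
  have hGm : Measurable G := by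
    have : Measurable fun ω => (((N.active i ω).toNat : ℕ) : ℝ) :=
      (Measurable.of_discrete (f := fun b : Bool => ((b.toNat : ℕ) : ℝ))).comp ham
    refine measurable_expNeg.comp ((Measurable.const_mul ?_ _).const_mul _)
    exact (((this.mul hgm).mul_const _).mul_const _).ennreal_ofReal
  have hG1 : ∀ ω, G ω ≤ 1 := fun ω => expNeg_le_one _
  have hgpos : ∀ᵐ ω ∂μ, 0 < p * N.gain i ω := by
    have hl := hN.gain_law i
    rw [← hl.map_eq] at hν
    exact ae_of_ae_map hl.aemeasurable hν
  -- The complement 1 - G, unlike G, is a product of a function of the gain and the activity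
  -- indicator, since an inactive BS causes no loss. Independence then gives w times the loss.
  have h1 : ∀ᵐ ω ∂μ, 1 - G ω = H (p * N.gain i ω) * b (N.active i ω) := by
    filter_upwards [hgpos] with ω hω
    cases hact : N.active i ω
    · simp [hG, hb, hact]
    · have hg : 0 < N.gain i ω := (mul_pos_iff_of_pos_left hp).1 hω
      simp only [hG, hb, hact, Bool.toNat_true, Nat.cast_one, one_mul, if_true, mul_one, hH]
      rw [← ENNReal.ofReal_mul hT.le, ← ENNReal.ofReal_mul (by positivity),
        expNeg_ofReal (by positivity), ENNReal.ofReal_sub _ (Real.exp_pos _).le,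
        ENNReal.ofReal_one, Real.div_rpow hR'.le hx'.le, Real.rpow_neg hx'.le]
      congr 4
      field_simp
  have h2 : ∫⁻ ω, (1 - G ω) ∂μ = interferenceLoss T p α ν R x * ENNReal.ofReal (w i.1) := by
    have hind : IndepFun (fun ω => H (p * N.gain i ω)) (fun ω => b (N.active i ω)) μ :=
      (hN.indep_gain_active i).comp (hHm.comp (measurable_id.const_mul p)) hbm
    rw [lintegral_congr_ae h1]
    have h3 := lintegral_mul_eq_lintegral_mul_lintegral_of_indepFun
      (hHm.comp (hgm.const_mul p)) (hbm.comp ham) hind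
    refine h3.trans ?_
    congr 1
    · have hl := hN.gain_law i
      rw [interferenceLoss, ← hl.map_eq, lintegral_map' hHm.aemeasurable hl.aemeasurable]
      rfl
    · rw [← hN.active_law i hi]
      have hms : MeasurableSet {ω | N.active i ω = true} := ham (measurableSet_singleton true)
      rw [← lintegral_indicator_one hms]
      refine lintegral_congr fun ω => ?_
      simp [hb, indicator_apply]
  rw [mul_comm, ← h2, lintegral_sub hGm (ne_top_of_le_ne_top ENNReal.one_ne_top ?_)
    (.of_forall hG1)]
  · simp only [lintegral_const, measure_univ, mul_one]
    rw [ENNReal.sub_sub_cancel ENNReal.one_ne_top]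
    calc ∫⁻ ω, G ω ∂μ ≤ ∫⁻ _, 1 ∂μ := lintegral_mono hG1
      _ = 1 := by simp
  · calc ∫⁻ ω, G ω ∂μ ≤ ∫⁻ _, 1 ∂μ := lintegral_mono hG1
      _ = 1 := by simp

end CellularNetwork.IsModel

namespace CellularNetwork.IsModel

variable {K : ℕ} {Ω : Type*} [MeasurableSpace Ω] {μ : Measure Ω} [IsProbabilityMeasure μ]
  {S : Finset (Fin (K + 1))} {lam w : Fin (K + 1) → ℝ} {α p T s : ℝ} {ν : Measure ℝ}
  {N : CellularNetwork K Ω}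

/-- Averaging over the gains and the activities of the interferers. -/
lemma lintegral_expNeg_configInterference (hN : N.IsModel μ S lam w p ν) (hp : 0 < p) (hT : 0 < T)
    (hν : ∀ᵐ g ∂ν, 0 < g) (c : Fin (K + 1) → ℕ∞ × (ℕ → Plane)) {R : ℝ≥0} (hR : 0 < R)
    (hc : (configDist (insert 0 S) c).toNNReal = R) :
    ∫⁻ ω, expNeg (ENNReal.ofReal ((R : ℝ) ^ α / p) * (ENNReal.ofReal T *
        (configInterference (insert 0 S) p α c (fun i => (N.gain i ω, N.active i ω)) +
          ENNReal.ofReal s))) ∂μ =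
      expNeg (ENNReal.ofReal ((R : ℝ) ^ α / p) * (ENNReal.ofReal T * ENNReal.ofReal s) +
        ∑ k ∈ insert 0 S, pointSum (fun c : Fin (K + 1) → ℕ∞ × (ℕ → Plane) => (c k).1)
          (fun n c => (c k).2 n) (fun x => if ‖x‖₊ ≤ R then 0 else
            negLog (1 - ENNReal.ofReal (w k) * interferenceLoss T p α ν R x)) c) := by
  classical
  -- With the configuration frozen, each term of the interference depends only on the mark of its
  -- own BS, so the terms are independent.
  set f : Fin (K + 1) × ℕ → ℝ × Bool → ℝ≥0∞ := fun i m =>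
    if i.1 ∈ insert 0 S ∧ (i.2 : ℕ∞) < (c i.1).1 ∧ R < ‖(c i.1).2 i.2‖₊ then
      ENNReal.ofReal ((R : ℝ) ^ α / p) * (ENNReal.ofReal T *
        ENNReal.ofReal ((m.2.toNat : ℝ) * m.1 * ‖(c i.1).2 i.2‖ ^ (-α) * p))
    else 0 with hf
  have hfm : ∀ i, Measurable (f i) := fun i => by
    refine Measurable.ite (MeasurableSet.const _) ?_ measurable_const
    have : Measurable fun m : ℝ × Bool => ((m.2.toNat : ℕ) : ℝ) :=
      (Measurable.of_discrete (f := fun b : Bool => ((b.toNat : ℕ) : ℝ))).comp measurable_snd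
    refine Measurable.const_mul (Measurable.const_mul ?_ _) _
    exact (((this.mul measurable_fst).mul_const _).mul_const _).ennreal_ofReal
  have e1 : ∀ ω, ENNReal.ofReal ((R : ℝ) ^ α / p) * (ENNReal.ofReal T *
        (configInterference (insert 0 S) p α c (fun i => (N.gain i ω, N.active i ω)) +
          ENNReal.ofReal s)) =
      ENNReal.ofReal ((R : ℝ) ^ α / p) * (ENNReal.ofReal T * ENNReal.ofReal s) +
      ∑' i, f i (N.gain i ω, N.active i ω) := fun ω => by
    rw [mul_add, mul_add, add_comm, configInterference, hc, ← ENNReal.tsum_mul_left,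
      ← ENNReal.tsum_mul_left]
    congr 1
    refine tsum_congr fun i => ?_
    simp only [hf, mul_ite, mul_zero]
  have hind := hN.indep_marks.comp f hfm
  have hmm : ∀ i, Measurable fun ω => f i (N.gain i ω, N.active i ω) := fun i =>
    (hfm i).comp ((hN.measurable_gain i).prodMk (hN.measurable_active i))
  simp_rw [e1, expNeg_add]
  rw [lintegral_const_mul' _ _ (expNeg_ne_top _)]
  congr 1
  refine (lintegral_expNeg_tsum_of_iIndepFun hind hmm).trans ?_
  congr 1
  -- The averaged factor of each BS is rewritten as the exponential of minus a weight at its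
  -- location, which turns the product back into a sum over points.
  have e2 : ∀ i, negLog (∫⁻ ω, expNeg (f i (N.gain i ω, N.active i ω)) ∂μ) =
      if i.1 ∈ insert 0 S then (if (i.2 : ℕ∞) < (c i.1).1 then
        (if ‖(c i.1).2 i.2‖₊ ≤ R then 0 else negLog (1 - ENNReal.ofReal (w i.1) *
          interferenceLoss T p α ν R ((c i.1).2 i.2))) else 0) else 0 := fun i => by
    have hnl : negLog 1 = 0 := by simp [negLog]
    by_cases h1 : i.1 ∈ insert 0 S
    · by_cases h2 : (i.2 : ℕ∞) < (c i.1).1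
      · by_cases h3 : R < ‖(c i.1).2 i.2‖₊
        · rw [if_pos h1, if_pos h2, if_neg (not_le.2 h3),
            ← hN.lintegral_expNeg_interferer hp hT hν h1 hR h3]
          simp only [hf, h1, h2, h3, and_self, if_true]
        · simp [hf, h3, hnl, not_lt.1 h3]
      · simp [hf, h2, hnl]
    · simp only [hf, h1, false_and, if_false, expNeg_zero, lintegral_const, measure_univ, mul_one,
        hnl]
  refine (tsum_congr e2).trans ?_
  rw [ENNReal.tsum_prod', tsum_fintype, ← Finset.sum_filter_add_sum_filter_not Finset.univ
    (· ∈ insert 0 S)]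
  rw [Finset.sum_eq_zero (s := Finset.univ.filter (· ∉ insert 0 S)), add_zero,
    Finset.filter_mem_eq_inter, Finset.univ_inter]
  · refine Finset.sum_congr rfl fun k hk => ?_
    simp only [hk, if_true]
    rfl
  · intro k hk
    simp [(Finset.mem_filter.1 hk).2]

/-- The coverage probability as an average over the distance of the serving BS. -/
lemma measure_lt_sinr (hN : N.IsModel μ S lam w p ν) (hlam : ∀ k, 0 ≤ lam k)
    (hpos : 0 < ∑ k ∈ insert 0 S, lam k) (hw : ∀ k ∈ insert 0 S, 0 ≤ w k)
    (hα : 2 < α) (hp : 0 < p) (hT : 0 < T) (hs : 0 ≤ s)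
    (hν : ∀ᵐ g ∂ν, 0 < g) (hβ : Integrable (betaTerm T p α) ν) :
    μ {ω | ENNReal.ofReal T < N.sinr S p α s ω} =
      ∫⁻ z in Ioi 0, ENNReal.ofReal (Real.pi * (∑ k ∈ insert 0 S, lam k) *
        Real.exp (-(Real.pi * (∑ k ∈ insert 0 S, lam k) * z))) * ENNReal.ofReal (Real.exp (-(
          T * s / p * z ^ (α / 2) +
          Real.pi * interfererIntensity S w lam * (betaConst T p α ν - 1) * z))) := by
  classical
  have := hN.isProbabilityMeasure_gain
  set U : Finset (Fin (K + 1)) := insert 0 S with hU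
  set D : Ω → ℝ≥0∞ := nearestDist N.num N.loc U with hD
  set R : Ω → ℝ≥0 := fun ω => (D ω).toNNReal with hR
  set conf : Ω → Fin (K + 1) → ℕ∞ × (ℕ → Plane) := fun ω k => (N.num k ω, fun n => N.loc k n ω)
    with hconf
  set marks : Ω → Fin (K + 1) × ℕ → ℝ × Bool := fun ω i => (N.gain i ω, N.active i ω) with hmarks
  have hcm : Measurable conf := measurable_pi_iff.2 fun k => (hN.ppp k).measurable_num.prodMk
    (measurable_pi_iff.2 fun n => (hN.ppp k).measurable_point n)
  have hmm : Measurable marks := measurable_pi_iff.2 fun i =>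
    (hN.measurable_gain i).prodMk (hN.measurable_active i)
  have hDm : Measurable D :=
    measurable_nearestDist (fun k => (hN.ppp k).measurable_num) fun k => (hN.ppp k).measurable_point
  have hfin : ∀ᵐ ω ∂μ, D ω ≠ ∞ := nearestDist_ne_top hN.ppp hN.indep_ppp hlam hpos
  have hlaw := hasLaw_nearestDist_sq hN.ppp hN.indep_ppp hlam hpos
  -- The squared distance has a density, so 0 is avoided almost surely. At distance 0 the power
  -- R^(-α) is a default value and the fading identity fails.
  have hR0 : ∀ᵐ ω ∂μ, 0 < R ω := by
    have h0 : ∀ᵐ z ∂(expMeasure (Real.pi * ∑ k ∈ U, lam k)), z ≠ 0 := by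
      have hac : expMeasure (Real.pi * ∑ k ∈ U, lam k) ≪ volume :=
        withDensity_absolutelyContinuous _ _
      exact hac.ae_le (Measure.ae_ne volume 0)
    rw [← hlaw.map_eq] at h0
    filter_upwards [ae_of_ae_map hlaw.aemeasurable h0] with ω hω
    refine pos_iff_ne_zero.2 fun h => hω ?_
    have : (D ω).toReal = 0 := by rw [← NNReal.coe_zero, ← h]; rfl
    change (D ω).toReal ^ 2 = 0
    rw [this]; simp
  -- the signal
  set F : ((Fin (K + 1) → ℕ∞ × (ℕ → Plane)) × (Fin (K + 1) × ℕ → ℝ × Bool)) → ℝ → ℝ≥0∞ :=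
    fun z g => {y : (Fin (K + 1) → ℕ∞ × (ℕ → Plane)) × (Fin (K + 1) × ℕ → ℝ × Bool) × ℝ |
      ENNReal.ofReal T * (configInterference U p α y.1 y.2.1 + ENNReal.ofReal s) <
        ENNReal.ofReal (y.2.2 * (configDist U y.1).toReal ^ (-α) * p)}.indicator 1 (z.1, z.2, g)
    with hF
  have hFm : Measurable (Function.uncurry F) := by
    refine (Measurable.indicator measurable_one ?_).comp
      (g := fun y : (Fin (K + 1) → ℕ∞ × (ℕ → Plane)) × (Fin (K + 1) × ℕ → ℝ × Bool) × ℝ =>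
        _) (f := fun z : ((Fin (K + 1) → ℕ∞ × (ℕ → Plane)) ×
          (Fin (K + 1) × ℕ → ℝ × Bool)) × ℝ => (z.1.1, z.1.2, z.2)) (by fun_prop)
    refine measurableSet_lt (Measurable.const_mul (Measurable.add_const ?_ _) _)
      (Measurable.ennreal_ofReal (Measurable.mul_const (Measurable.mul (by fun_prop)
        (Measurable.pow_const ?_ _)) _))
    · exact (measurable_configInterference U p α).comp
        (g := Function.uncurry (configInterference U p α)) (f := fun y :
        (Fin (K + 1) → ℕ∞ × (ℕ → Plane)) × (Fin (K + 1) × ℕ → ℝ × Bool) × ℝ => (y.1, y.2.1))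
        (by fun_prop)
    · exact ((measurable_configDist U).comp measurable_fst).ennreal_toReal
  have step1 : μ {ω | ENNReal.ofReal T < N.sinr S p α s ω} =
      ∫⁻ ω, F (conf ω, marks ω) (N.signalGain ω) ∂μ := by
    have hset : {ω | ENNReal.ofReal T < N.sinr S p α s ω} =ᵐ[μ]
        {ω | ENNReal.ofReal T * (configInterference U p α (conf ω) (marks ω) + ENNReal.ofReal s) <
          ENNReal.ofReal (N.signalGain ω * (configDist U (conf ω)).toReal ^ (-α) * p)} := by
      rw [eventuallyEq_set]
      filter_upwards [hfin] with ω hω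
      rw [lt_sinr_iff N S p α s hT, interference_eq N S p α hω, servingDist_eq]
      rfl
    rw [measure_congr hset, ← lintegral_indicator_one]
    · rfl
    · have := hFm.comp ((hcm.prodMk hmm).prodMk hN.measurable_signalGain)
      have h1 := this (measurableSet_singleton 1)
      refine (congrArg MeasurableSet ?_).mp h1
      ext ω
      simp [hF, indicator_apply]
  -- The configuration and marks are frozen, and only the exponential signal gain is integrated out.
  have step2 : ∫⁻ ω, F (conf ω, marks ω) (N.signalGain ω) ∂μ =
      ∫⁻ ω, expNeg (ENNReal.ofReal ((R ω : ℝ) ^ α / p) * (ENNReal.ofReal T *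
        (configInterference U p α (conf ω) (marks ω) + ENNReal.ofReal s))) ∂μ := by
    rw [lintegral_eq_lintegral_lintegral_of_indepFun hN.indep_signal (hcm.prodMk hmm)
      hN.measurable_signalGain hFm]
    refine lintegral_congr_ae ?_
    filter_upwards [hR0] with ω hω
    rw [← hN.measure_lt_signal hp (by exact_mod_cast hω), ← lintegral_indicator_one]
    · rfl
    · exact measurableSet_lt measurable_const
        ((hN.measurable_signalGain.mul_const _).mul_const _).ennreal_ofReal
  -- the marks of the interferers
  set C : ℝ≥0 → ℝ≥0∞ := fun r =>
    ENNReal.ofReal ((r : ℝ) ^ α / p) * (ENNReal.ofReal T * ENNReal.ofReal s) with hC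
  set f : Fin (K + 1) → ℝ≥0 → Plane → ℝ≥0∞ := fun k r x =>
    negLog (1 - ENNReal.ofReal (w k) * interferenceLoss T p α ν r x) with hf
  have step3 : ∫⁻ ω, expNeg (ENNReal.ofReal ((R ω : ℝ) ^ α / p) * (ENNReal.ofReal T *
        (configInterference U p α (conf ω) (marks ω) + ENNReal.ofReal s))) ∂μ =
      ∫⁻ ω, expNeg (C (R ω) + ∑ k ∈ U, pointSum (N.num k) (N.loc k)
        (fun x => if ‖x‖₊ ≤ R ω then 0 else f k (R ω) x) ω) ∂μ := by
    have hGm : Measurable (Function.uncurry fun (c : Fin (K + 1) → ℕ∞ × (ℕ → Plane))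
        (m : Fin (K + 1) × ℕ → ℝ × Bool) =>
        expNeg (ENNReal.ofReal (((configDist U c).toNNReal : ℝ) ^ α / p) * (ENNReal.ofReal T *
          (configInterference U p α c m + ENNReal.ofReal s)))) := by
      refine measurable_expNeg.comp (Measurable.mul (Measurable.ennreal_ofReal (Measurable.div_const
        (Measurable.pow_const ?_ _) _)) (Measurable.const_mul (Measurable.add_const
          (measurable_configInterference U p α) _) _))
      exact ((measurable_configDist U).comp measurable_fst).ennreal_toNNReal.coe_nnreal_real
    refine (lintegral_eq_lintegral_lintegral_of_indepFun hN.indep_loc_marks hcm hmm hGm).trans ?_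
    refine lintegral_congr_ae ?_
    filter_upwards [hR0] with ω hω
    exact hN.lintegral_expNeg_configInterference hp hT hν (conf ω) hω rfl
  -- Activity and fading now sit entirely in the weights `f`, so the unmarked Poisson processes
  -- suffice. The side conditions follow because the loss increases continuously in r and y ↦ -log(1
  -- - y) is increasing and continuous.
  have step4 := lintegral_expNeg_beyond_nearestDist hN.ppp hN.indep_ppp hlam U hfin (f := f) (C := C)
    (fun k r => measurable_negLog.comp (measurable_const.sub
      ((measurable_interferenceLoss r).const_mul _)))
    (fun k x r r' h => negLog_antitone (tsub_le_tsub_left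
      (mul_le_mul_right (monotone_interferenceLoss hT hp hα hν x h) _) _))
    (fun k x => continuous_negLog.comp (Continuous.comp (g := fun y : ℝ≥0∞ => 1 - y)
      (ENNReal.continuous_sub_left ENNReal.one_ne_top)
      ((ENNReal.continuous_const_mul ENNReal.ofReal_ne_top).comp
        (continuous_interferenceLoss hα x))))
    (by
      refine (ENNReal.continuous_mul_const (ENNReal.mul_ne_top ENNReal.ofReal_ne_top
        ENNReal.ofReal_ne_top)).comp (ENNReal.continuous_ofReal.comp (Continuous.div_const ?_ _))
      exact NNReal.continuous_coe.rpow_const fun _ => Or.inr (by linarith)) (R := R) rfl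
  have hβ1 := one_le_betaConst hα hT hp hν hβ
  have hb0 : 0 ≤ ∑ k ∈ U, w k * lam k :=
    Finset.sum_nonneg fun k hk => mul_nonneg (hw k hk) (hlam k)
  -- For y ≤ 1 the weight -log(1 - y) satisfies 1 - exp(-weight) = y, so the logarithm disappears
  -- and MNO k contributes w_k λ_k π r² (β - 1) to the exponent.
  have step5 : ∀ r : ℝ≥0, 0 < r → expNeg (C r + ∑ k ∈ U, ENNReal.ofReal (lam k) *
        ∫⁻ x, (1 - expNeg (if ‖x‖₊ ≤ r then 0 else f k r x))) =
      ENNReal.ofReal (Real.exp (-(T * s / p * ((r : ℝ) ^ 2) ^ (α / 2) +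
        Real.pi * interfererIntensity S w lam * (betaConst T p α ν - 1) * (r : ℝ) ^ 2))) :=
    fun r hr => by
    have e1 : ∀ k ∈ U, ENNReal.ofReal (lam k) *
        ∫⁻ x, (1 - expNeg (if ‖x‖₊ ≤ r then 0 else f k r x)) =
        ENNReal.ofReal (w k * lam k * (Real.pi * (r : ℝ) ^ 2 * (betaConst T p α ν - 1))) :=
      fun k hk => by
      have e2 : ∀ x, 1 - expNeg (if ‖x‖₊ ≤ r then 0 else f k r x) = ENNReal.ofReal (w k) *
          (if ‖x‖₊ ≤ r then 0 else interferenceLoss T p α ν r x) := fun x => by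
        split_ifs
        · simp
        · rw [hf, expNeg_negLog tsub_le_self, ENNReal.sub_sub_cancel ENNReal.one_ne_top]
          exact mul_le_one' (hN.activity_le_one hk) (interferenceLoss_le_one r x)
      simp_rw [e2]
      rw [lintegral_const_mul' _ _ ENNReal.ofReal_ne_top,
        lintegral_interferenceLoss hα hT hp hν hβ hr, ← mul_assoc, ← ENNReal.ofReal_mul (hlam k),
        ← ENNReal.ofReal_mul (mul_nonneg (hlam k) (hw k hk)), mul_comm (lam k)]
    have hm0 : 0 ≤ Real.pi * (r : ℝ) ^ 2 * (betaConst T p α ν - 1) :=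
      mul_nonneg (by positivity) (by linarith)
    rw [Finset.sum_congr rfl e1, ← ENNReal.ofReal_sum_of_nonneg
      fun k hk => mul_nonneg (mul_nonneg (hw k hk) (hlam k)) hm0, ← Finset.sum_mul, hC]
    dsimp only
    rw [← ENNReal.ofReal_mul hT.le, ← ENNReal.ofReal_mul (by positivity),
      ← ENNReal.ofReal_add (by positivity) (mul_nonneg hb0 hm0),
      expNeg_ofReal (add_nonneg (by positivity) (mul_nonneg hb0 hm0))]
    have e3 : ((r : ℝ) ^ 2) ^ (α / 2) = (r : ℝ) ^ α := by
      rw [← Real.rpow_natCast, ← Real.rpow_mul r.coe_nonneg]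
      congr 1
      push_cast
      ring
    rw [e3, interfererIntensity]
    congr 3
    ring
  rw [step1, step2, step3, step4, ← lintegral_expMeasure _ (F := fun z => ENNReal.ofReal
    (Real.exp (-(T * s / p * z ^ (α / 2) +
      Real.pi * interfererIntensity S w lam * (betaConst T p α ν - 1) * z)))) (by fun_prop),
    ← hlaw.map_eq, lintegral_map' (by fun_prop) hlaw.aemeasurable]
  refine lintegral_congr_ae ?_
  filter_upwards [hR0] with ω hω
  exact step5 (R ω) hω

end CellularNetwork.IsModel

/-! ### Asymptotics of the coverage integral -/

section CoverageIntegral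

variable {A B α : ℝ}

lemma integrableOn_exp_neg_add_rpow (hA : 0 < A) (hB : 0 ≤ B) (α : ℝ) :
    IntegrableOn (fun z : ℝ => Real.exp (-(A * z + B * z ^ (α / 2)))) (Ioi 0) := by
  refine Integrable.mono' (exp_neg_integrableOn_Ioi 0 hA) (by fun_prop) ?_
  refine (ae_restrict_iff' measurableSet_Ioi).2 (.of_forall fun z hz => ?_)
  rw [Real.norm_eq_abs, Real.abs_exp]
  have : 0 ≤ B * z ^ (α / 2) := mul_nonneg hB (Real.rpow_nonneg (le_of_lt hz) _)
  refine Real.exp_le_exp.2 ?_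
  linarith

lemma integral_exp_neg_mul_Ioi (hA : 0 < A) : ∫ z in Ioi (0 : ℝ), Real.exp (-(A * z)) = A⁻¹ := by
  have := integral_comp_mul_left_Ioi (fun x => Real.exp (-x)) 0 hA
  rw [this, mul_zero, integral_exp_neg_Ioi_zero, smul_eq_mul, mul_one]

lemma tendsto_integral_exp_neg_zero (hA : 0 < A) :
    Tendsto (fun B => ∫ z in Ioi (0 : ℝ), Real.exp (-(A * z + B * z ^ (α / 2)))) (𝓝[>] 0)
      (𝓝 A⁻¹) := by
  rw [← integral_exp_neg_mul_Ioi hA]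
  refine tendsto_integral_filter_of_dominated_convergence (fun z => Real.exp (-A * z)) ?_ ?_
    (exp_neg_integrableOn_Ioi 0 hA) ?_
  · exact .of_forall fun B => by fun_prop
  · filter_upwards [self_mem_nhdsWithin] with B hB
    refine (ae_restrict_iff' measurableSet_Ioi).2 (.of_forall fun z hz => ?_)
    rw [Real.norm_eq_abs, Real.abs_exp]
    have : 0 ≤ B * z ^ (α / 2) := mul_nonneg (le_of_lt hB) (Real.rpow_nonneg (le_of_lt hz) _)
    refine Real.exp_le_exp.2 ?_
    linarith
  · refine .of_forall fun z => ?_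
    have h : Continuous fun B : ℝ => Real.exp (-(A * z + B * z ^ (α / 2))) := by fun_prop
    have := (h.tendsto 0).mono_left (nhdsWithin_le_nhds (s := Ioi 0))
    simpa using this

/-- The substitution z = B^(-2/α) x removes B from the power term and leaves the vanishing
coefficient A B^(-2/α) in the linear one; exp(-x^(α/2)) dominates, and its integral is Γ(2/α + 1).
-/
lemma tendsto_rpow_mul_integral_exp_neg (hA : 0 < A) (hα : 0 < α) :
    Tendsto (fun B => B ^ (2 / α) *
      ∫ z in Ioi (0 : ℝ), Real.exp (-(A * z + B * z ^ (α / 2)))) atTop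
      (𝓝 (Real.Gamma (2 / α + 1))) := by
  have hq : 0 < α / 2 := by positivity
  have hG := integral_exp_neg_rpow hq
  rw [one_div_div] at hG
  rw [← hG]
  have hint : IntegrableOn (fun x : ℝ => Real.exp (-x ^ (α / 2))) (Ioi 0) := by
    simpa using integrableOn_rpow_mul_exp_neg_rpow (s := 0) (by norm_num) hq
  have h1 : Tendsto (fun B : ℝ => ∫ x in Ioi (0 : ℝ),
      Real.exp (-(A * B ^ (-(2 / α)) * x + x ^ (α / 2)))) atTop
      (𝓝 (∫ x in Ioi (0 : ℝ), Real.exp (-x ^ (α / 2)))) := by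
    refine tendsto_integral_filter_of_dominated_convergence _ ?_ ?_ hint ?_
    · exact .of_forall fun B => by fun_prop
    · filter_upwards [eventually_gt_atTop 0] with B hB
      refine (ae_restrict_iff' measurableSet_Ioi).2 (.of_forall fun z hz => ?_)
      rw [Real.norm_eq_abs, Real.abs_exp]
      have hz' : 0 < z := hz
      have : 0 ≤ A * B ^ (-(2 / α)) * z := by positivity
      refine Real.exp_le_exp.2 ?_
      linarith
    · refine .of_forall fun x => ?_
      have h : Continuous fun y : ℝ => Real.exp (-(A * y * x + x ^ (α / 2))) := by fun_prop
      have := (h.tendsto 0).comp (tendsto_rpow_neg_atTop (y := 2 / α) (by positivity))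
      simpa [Function.comp_def] using this
  refine h1.congr' ?_
  filter_upwards [eventually_gt_atTop 0] with B hB
  have hb : 0 < B ^ (-(2 / α)) := by positivity
  have h2 := integral_comp_mul_left_Ioi
    (fun z : ℝ => Real.exp (-(A * z + B * z ^ (α / 2)))) 0 hb
  rw [mul_zero, smul_eq_mul, ← Real.rpow_neg hB.le, neg_neg] at h2
  rw [← h2]
  refine setIntegral_congr_fun measurableSet_Ioi fun x hx => ?_
  have hx' : 0 < x := hx
  have : B * (B ^ (-(2 / α)) * x) ^ (α / 2) = x ^ (α / 2) := by
    rw [Real.mul_rpow hb.le hx'.le, ← Real.rpow_mul hB.le,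
      show -(2 / α) * (α / 2) = -1 by field_simp, Real.rpow_neg_one, mul_inv_cancel_left₀ hB.ne']
  simp only [this]
  congr 3
  ring

/-- As B → 0 both functions tend to π lamA / A. As B → ∞ both decay like B^(-2/α), with equal
constants. -/
lemma approxCoverage_isEquivalent {lamA : ℝ} (hlamA : 0 < lamA) (hA : 0 < A) (hα : 0 < α)
    {l : Filter ℝ} (hl : l = 𝓝[>] 0 ∨ l = atTop) :
    Asymptotics.IsEquivalent l
      (fun B => Real.pi * lamA * ∫ z in Ioi (0 : ℝ), Real.exp (-(A * z + B * z ^ (α / 2))))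
      (fun B => approxCoverage lamA A B α) := by
  have hΓ : 0 < Real.Gamma (2 / α) := Real.Gamma_pos_of_pos (by positivity)
  have hc : 0 < Real.pi * lamA := by positivity
  rcases hl with rfl | rfl
  · have h1 := (tendsto_integral_exp_neg_zero (α := α) hA).const_mul (Real.pi * lamA)
    have h2 : Tendsto (fun B => approxCoverage lamA A B α) (𝓝[>] 0)
        (𝓝 (Real.pi * lamA * A⁻¹)) := by
      have h3 : Tendsto (fun B : ℝ => A + α / 2 * (B ^ (2 / α) / Real.Gamma (2 / α))) (𝓝 0)
          (𝓝 A) := by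
        have : Continuous fun B : ℝ => A + α / 2 * (B ^ (2 / α) / Real.Gamma (2 / α)) :=
          continuous_const.add (continuous_const.mul
            ((Real.continuous_rpow_const (by positivity)).div_const _))
        have h := this.tendsto 0
        rwa [Real.zero_rpow (by positivity), zero_div, mul_zero, add_zero] at h
      exact ((h3.mono_left nhdsWithin_le_nhds).inv₀ hA.ne').const_mul _
    have hne : Real.pi * lamA * A⁻¹ ≠ 0 := by positivity
    exact ((Asymptotics.isEquivalent_const_iff_tendsto hne).2 h1).trans
      ((Asymptotics.isEquivalent_const_iff_tendsto hne).2 h2).symm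
  · refine Asymptotics.isEquivalent_of_tendsto_one ?_
    have h1 := tendsto_rpow_mul_integral_exp_neg hA hα
    have h2 : Tendsto (fun B : ℝ => A * B ^ (-(2 / α)) + α / 2 / Real.Gamma (2 / α)) atTop
        (𝓝 (α / 2 / Real.Gamma (2 / α))) := by
      simpa using ((tendsto_rpow_neg_atTop (y := 2 / α) (by positivity)).const_mul A).add_const
        (α / 2 / Real.Gamma (2 / α))
    have h3 := h1.mul h2
    -- Γ(2/α + 1) = (2/α) Γ(2/α): this is why the approximation carries the coefficient α/2.
    have e : Real.Gamma (2 / α + 1) * (α / 2 / Real.Gamma (2 / α)) = 1 := by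
      rw [Real.Gamma_add_one (by positivity)]
      field_simp
    rw [e] at h3
    refine h3.congr' ?_
    filter_upwards [eventually_gt_atTop 0] with B hB
    have hBp : 0 < B ^ (2 / α) := by positivity
    rw [Pi.div_apply, approxCoverage, Real.rpow_neg hB.le]
    have hpos : 0 < A + α / 2 * (B ^ (2 / α) / Real.Gamma (2 / α)) := by positivity
    field_simp

end CoverageIntegral

/-! ### Association probabilities -/

section Superposition

variable {Ω κ : Type*} [MeasurableSpace Ω] {μ : Measure Ω}
  {num : κ → Ω → ℕ∞} {X : κ → ℕ → Ω → Plane} {lam : κ → ℝ}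

lemma indepFun_nearestDist (hppp : ∀ k, IsHomogeneousPPP μ (num k) (X k) (lam k))
    (hind : iIndepFun (fun k ω => (num k ω, fun n => X k n ω)) μ) {U V : Finset κ}
    (hUV : Disjoint U V) : IndepFun (nearestDist num X U) (nearestDist num X V) μ := by
  classical
  have h := iIndepFun.indepFun_finset U V hUV hind fun k => (hppp k).measurable_num.prodMk
    (measurable_pi_iff.2 fun n => (hppp k).measurable_point n)
  -- The values chosen outside W are never read, because the infimum runs over W only.
  set F : ∀ W : Finset κ, (W → ℕ∞ × (ℕ → Plane)) → ℝ≥0∞ := fun W =>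
    nearestDist (fun k c => if h : k ∈ W then (c ⟨k, h⟩).1 else 0)
      (fun k n c => if h : k ∈ W then (c ⟨k, h⟩).2 n else 0) W with hF
  have hFm : ∀ W, Measurable (F W) := fun W => by
    refine measurable_nearestDist (fun k => ?_) fun k n => ?_
    · by_cases hk : k ∈ W <;> simp only [hk, dite_true, dite_false] <;> fun_prop
    · by_cases hk : k ∈ W <;> simp only [hk, dite_true, dite_false] <;> fun_prop
  have hFe : ∀ W : Finset κ, F W ∘ (fun ω (k : W) => (num k ω, fun n => X k n ω)) =
      nearestDist num X W := fun W => by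
    ext ω
    simp only [hF, Function.comp_apply, nearestDist]
    refine iInf_congr fun k => iInf_congr fun hk => ?_
    simp only [hk, dite_true]
  rw [← hFe U, ← hFe V]
  exact h.comp (hFm U) (hFm V)

/-- The probability that the nearest point belongs to `U` rather than to `V` is the proportion of
the intensity of `U`. -/
lemma measure_nearestDist_le [IsProbabilityMeasure μ]
    (hppp : ∀ k, IsHomogeneousPPP μ (num k) (X k) (lam k))
    (hind : iIndepFun (fun k ω => (num k ω, fun n => X k n ω)) μ) (hlam : ∀ k, 0 ≤ lam k)
    {U V : Finset κ} (hUV : Disjoint U V) :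
    μ {ω | nearestDist num X U ω ≠ ∞ ∧ nearestDist num X U ω ≤ nearestDist num X V ω} =
      ENNReal.ofReal ((∑ k ∈ U, lam k) / (∑ k ∈ U, lam k + ∑ k ∈ V, lam k)) := by
  have hm : ∀ W : Finset κ, Measurable (nearestDist num X W) := fun W =>
    measurable_nearestDist (fun k => (hppp k).measurable_num) fun k => (hppp k).measurable_point
  have hE : MeasurableSet {d : ℝ≥0∞ × ℝ≥0∞ | d.1 ≠ ∞ ∧ d.1 ≤ d.2} :=
    (measurable_fst (measurableSet_singleton ∞).compl).inter
      (measurableSet_le measurable_fst measurable_snd)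
  have h1 := lintegral_eq_lintegral_lintegral_of_indepFun (indepFun_nearestDist hppp hind hUV)
    (hm U) (hm V) (F := fun d e => {d : ℝ≥0∞ × ℝ≥0∞ | d.1 ≠ ∞ ∧ d.1 ≤ d.2}.indicator 1 (d, e))
    (measurable_one.indicator hE)
  have h2 : ∫⁻ ω, {d : ℝ≥0∞ × ℝ≥0∞ | d.1 ≠ ∞ ∧ d.1 ≤ d.2}.indicator 1
      (nearestDist num X U ω, nearestDist num X V ω) ∂μ =
      μ {ω | nearestDist num X U ω ≠ ∞ ∧ nearestDist num X U ω ≤ nearestDist num X V ω} := by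
    exact lintegral_indicator_one (((hm U).prodMk (hm V)) hE)
  rw [h2] at h1
  rw [h1]
  -- With zero intensity the exponential law is unavailable; then U almost surely has no point, and
  -- both sides are 0.
  rcases (Finset.sum_nonneg fun k (_ : k ∈ U) => hlam k).eq_or_lt with h0 | hpos
  · rw [← h0, zero_div, ENNReal.ofReal_zero]
    have hall : ∀ᵐ ω ∂μ, ∀ n : ℕ, (n : ℝ≥0∞) ≤ nearestDist num X U ω := by
      refine ae_all_iff.2 fun n => ?_
      have := measure_le_nearestDist_eq_exp hppp hind hlam U (n : ℝ≥0)
      rw [← h0] at this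
      simp only [mul_zero, zero_mul, neg_zero, Real.exp_zero, ENNReal.ofReal_one,
        ENNReal.coe_natCast] at this
      exact (mem_ae_iff_prob_eq_one (measurableSet_le measurable_const (hm U))).2 this
    refine (lintegral_congr_ae ?_).trans lintegral_zero
    filter_upwards [hall] with ω hω
    have : nearestDist num X U ω = ∞ := ENNReal.eq_top_of_forall_nnreal_le fun r => by
      obtain ⟨n, hn⟩ := exists_nat_ge r
      exact le_trans (by exact_mod_cast hn) (hω n)
    simp [this]
  · have hlaw := hasLaw_nearestDist_sq hppp hind hlam hpos
    have hV : 0 ≤ ∑ k ∈ V, lam k := Finset.sum_nonneg fun k _ => hlam k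
    have h3 : ∀ᵐ ω ∂μ, ∫⁻ ω', {d : ℝ≥0∞ × ℝ≥0∞ | d.1 ≠ ∞ ∧ d.1 ≤ d.2}.indicator 1
        (nearestDist num X U ω, nearestDist num X V ω') ∂μ =
        ENNReal.ofReal (Real.exp (-(Real.pi * (∑ k ∈ V, lam k) *
          (nearestDist num X U ω).toReal ^ 2))) := by
      filter_upwards [nearestDist_ne_top hppp hind hlam hpos] with ω hω
      rw [ENNReal.toReal, ← measure_le_nearestDist_eq_exp hppp hind hlam V,
        ← lintegral_indicator_one (measurableSet_le measurable_const (hm V))]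
      refine lintegral_congr fun ω' => ?_
      simp only [indicator_apply, mem_ofPred_eq, hω, ne_eq, not_false_eq_true, true_and,
        ENNReal.coe_toNNReal hω, Pi.one_apply]
    have hG : Measurable fun z : ℝ =>
        ENNReal.ofReal (Real.exp (-(Real.pi * (∑ k ∈ V, lam k) * z))) := by fun_prop
    have hA : 0 < Real.pi * (∑ k ∈ U, lam k + ∑ k ∈ V, lam k) := by positivity
    rw [lintegral_congr_ae h3, ← lintegral_map' (f := fun z : ℝ =>
      ENNReal.ofReal (Real.exp (-(Real.pi * (∑ k ∈ V, lam k) * z)))) hG.aemeasurable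
      hlaw.aemeasurable, hlaw.map_eq, lintegral_expMeasure _ hG]
    have h4 : ∀ z : ℝ, ENNReal.ofReal (Real.pi * (∑ k ∈ U, lam k) *
        Real.exp (-(Real.pi * (∑ k ∈ U, lam k) * z))) *
        ENNReal.ofReal (Real.exp (-(Real.pi * (∑ k ∈ V, lam k) * z))) =
        ENNReal.ofReal (Real.pi * (∑ k ∈ U, lam k) *
          Real.exp (-(Real.pi * (∑ k ∈ U, lam k + ∑ k ∈ V, lam k) * z))) := fun z => by
      rw [← ENNReal.ofReal_mul (by positivity), mul_assoc _ (Real.exp _), ← Real.exp_add]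
      congr 3
      ring
    simp_rw [h4]
    have hi : IntegrableOn (fun z => Real.exp (-(Real.pi * (∑ k ∈ U, lam k + ∑ k ∈ V, lam k) * z)))
        (Ioi 0) := by
      simpa only [neg_mul] using exp_neg_integrableOn_Ioi 0 hA
    rw [← ofReal_integral_eq_lintegral_ofReal (hi.const_mul _)
      (.of_forall fun z => by positivity), integral_const_mul, integral_exp_neg_mul_Ioi hA]
    congr 1
    field_simp

/-- Almost surely, every disk contains finitely many points. -/
lemma ae_finite_points {num : Ω → ℕ∞} {X : ℕ → Ω → Plane} {lam : ℝ}
    (h : IsHomogeneousPPP μ num X lam) :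
    ∀ᵐ ω ∂μ, ∀ m : ℕ, {n : ℕ | (n : ℕ∞) < num ω ∧ X n ω ∈ Metric.ball 0 (m : ℝ)}.Finite := by
  refine ae_all_iff.2 fun m => ?_
  have hl := h.count_law (Metric.ball 0 (m : ℝ)) measurableSet_ball measure_ball_lt_top.ne
  have h1 : ∀ᵐ c ∂((poissonMeasure
      (lam * (volume (Metric.ball (0 : Plane) (m : ℝ))).toReal).toNNReal).map
        (Nat.cast : ℕ → ℕ∞)), c ≠ ⊤ :=
    (ae_map_iff (Measurable.of_discrete).aemeasurable .of_discrete).2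
      (.of_forall fun n => ENat.natCast_ne_top n)
  rw [← hl.map_eq] at h1
  filter_upwards [ae_of_ae_map hl.aemeasurable h1] with ω hω
  exact Set.encard_ne_top_iff.1 hω

end Superposition

namespace CellularNetwork.IsModel

variable {K : ℕ} {Ω : Type*} [MeasurableSpace Ω] {μ : Measure Ω} [IsProbabilityMeasure μ]
  {S : Finset (Fin (K + 1))} {lam w : Fin (K + 1) → ℝ} {p : ℝ} {ν : Measure ℝ}
  {N : CellularNetwork K Ω}

/-- The infimum of the distances is attained because a disk containing some BS contains only
finitely many. -/
lemma ae_exists_isServing (hN : N.IsModel μ S lam w p ν) (hlam : ∀ k, 0 ≤ lam k)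
    (hpos : 0 < ∑ k ∈ insert 0 S, lam k) : ∀ᵐ ω ∂μ, ∃ i, N.IsServing S ω i := by
  filter_upwards [nearestDist_ne_top hN.ppp hN.indep_ppp hlam hpos,
    ae_all_iff.2 fun k => ae_finite_points (hN.ppp k)] with ω hω hfin
  obtain ⟨m, hm⟩ := ENNReal.exists_nat_gt hω
  set A : Set (Fin (K + 1) × ℕ) := {i | i ∈ N.sharedBS S ω ∧ ‖N.pos i ω‖ < m} with hA
  have hAfin : A.Finite := by
    refine (Set.finite_iUnion fun k => (hfin k m).image (Prod.mk k)).subset fun i hi => ?_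
    refine mem_iUnion.2 ⟨i.1, i.2, ⟨hi.1.2, ?_⟩, rfl⟩
    rw [mem_ball_zero_iff]
    exact hi.2
  have hAne : A.Nonempty := by
    obtain ⟨k, hk, n, hn, hX⟩ := nearestDist_lt_iff.1 hm
    refine ⟨(k, n), ⟨hk, hn⟩, ?_⟩
    have : ‖N.loc k n ω‖₊ < (m : ℝ≥0) := by exact_mod_cast hX
    exact_mod_cast this
  obtain ⟨i, hi, hmin⟩ := Set.exists_min_image A (fun i => ‖N.pos i ω‖) hAfin hAne
  refine ⟨i, hi.1, fun j hj => ?_⟩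
  by_cases hjm : ‖N.pos j ω‖ < m
  · exact hmin j ⟨hj, hjm⟩
  · exact (hi.2.trans_le (not_lt.1 hjm)).le

lemma associationProb_le (hN : N.IsModel μ S lam w p ν) (hlam : ∀ k, 0 ≤ lam k)
    {k : Fin (K + 1)} (hk : k ∈ insert 0 S) :
    N.associationProb μ S k ≤ lam k / ∑ k ∈ insert 0 S, lam k := by
  have h := measure_nearestDist_le hN.ppp hN.indep_ppp hlam
    (U := {k}) (V := (insert 0 S).erase k) (by simp)
  rw [Finset.sum_singleton, Finset.add_sum_erase _ _ hk] at h
  refine ENNReal.toReal_le_of_le_ofReal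
    (div_nonneg (hlam k) (Finset.sum_nonneg fun k _ => hlam k)) ?_
  rw [← h]
  refine measure_mono ?_
  rintro ω ⟨n, hn⟩
  have hle : nearestDist N.num N.loc {k} ω ≤ (‖N.pos (k, n) ω‖₊ : ℝ≥0∞) :=
    le_nearestDist_iff.1 le_rfl k (Finset.mem_singleton_self k) n hn.1.2
  refine ⟨ne_top_of_le_ne_top ENNReal.coe_ne_top hle, hle.trans (le_nearestDist_iff.2 ?_)⟩
  intro j hj n' hn'
  exact ENNReal.coe_le_coe.2 (hn.2 (j, n') ⟨Finset.mem_of_mem_erase hj, hn'⟩)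

/-- The upper bounds λ_k/λ add up to 1, while the association events almost surely cover the whole
space, so every bound is an equality. No separate argument that ties have probability zero is
needed. -/
lemma associationProb_eq (hN : N.IsModel μ S lam w p ν) (hlam : ∀ k, 0 ≤ lam k)
    (hpos : 0 < ∑ k ∈ insert 0 S, lam k) :
    ∀ k ∈ insert 0 S, N.associationProb μ S k = lam k / ∑ k ∈ insert 0 S, lam k := by
  refine (Finset.sum_eq_sum_iff_of_le fun k hk => hN.associationProb_le hlam hk).1
    (le_antisymm (Finset.sum_le_sum fun k hk => hN.associationProb_le hlam hk) ?_)
  rw [← Finset.sum_div, div_self hpos.ne']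
  have h1 : μ.real (⋃ k ∈ insert 0 S, {ω | ∃ n : ℕ, N.IsServing S ω (k, n)}) = 1 := by
    have : (⋃ k ∈ insert 0 S, {ω | ∃ n : ℕ, N.IsServing S ω (k, n)}) =ᵐ[μ] univ := by
      rw [eventuallyEq_univ]
      filter_upwards [hN.ae_exists_isServing hlam hpos] with ω hω
      obtain ⟨i, hi⟩ := hω
      exact mem_biUnion (x := i.1) hi.1.1 ⟨i.2, hi⟩
    rw [measureReal_congr this, probReal_univ]
  rw [← h1]
  exact measureReal_biUnion_finset_le _ _

end CellularNetwork.IsModel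

/-! ### The coverage formula and the proposition -/

/-- The density πλ e^(-πλz) of the squared serving distance merges with the conditional coverage
into one exponential; this is the origin of the summand λ in A₂. -/
lemma CellularNetwork.IsModel.coverageProb_eq {K : ℕ} {Ω : Type*} [MeasurableSpace Ω]
    {μ : Measure Ω} [IsProbabilityMeasure μ] {S : Finset (Fin (K + 1))}
    {lam w : Fin (K + 1) → ℝ} {α p T s : ℝ} {ν : Measure ℝ} {N : CellularNetwork K Ω}
    (hN : N.IsModel μ S lam w p ν) (hlam : ∀ k, 0 ≤ lam k)
    (hpos : 0 < ∑ k ∈ insert 0 S, lam k) (hw : ∀ k ∈ insert 0 S, 0 ≤ w k)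
    (hα : 2 < α) (hp : 0 < p) (hT : 0 < T) (hs : 0 ≤ s)
    (hν : ∀ᵐ g ∂ν, 0 < g) (hβ : Integrable (betaTerm T p α) ν)
    (hA : 0 < Real.pi * (interfererIntensity S w lam * (betaConst T p α ν - 1) +
      ∑ k ∈ insert 0 S, lam k)) :
    N.coverageProb μ S p α s T = Real.pi * (∑ k ∈ insert 0 S, lam k) *
      ∫ z in Ioi (0 : ℝ), Real.exp (-(Real.pi * (interfererIntensity S w lam *
        (betaConst T p α ν - 1) + ∑ k ∈ insert 0 S, lam k) * z + T * s / p * z ^ (α / 2))) := by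
  set L := ∑ k ∈ insert 0 S, lam k
  set M := interfererIntensity S w lam
  set b := betaConst T p α ν
  have hi := integrableOn_exp_neg_add_rpow hA (B := T * s / p) (by positivity) α
  have h : ∀ z : ℝ, ENNReal.ofReal (Real.pi * L * Real.exp (-(Real.pi * L * z))) *
      ENNReal.ofReal (Real.exp (-(T * s / p * z ^ (α / 2) + Real.pi * M * (b - 1) * z))) =
      ENNReal.ofReal (Real.pi * L *
        Real.exp (-(Real.pi * (M * (b - 1) + L) * z + T * s / p * z ^ (α / 2)))) := fun z => by
    rw [← ENNReal.ofReal_mul (by positivity), mul_assoc _ (Real.exp _), ← Real.exp_add]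
    congr 3
    ring
  rw [CellularNetwork.coverageProb, measureReal_def,
    (hN.measure_lt_sinr hlam hpos hw hα hp hT hs hν hβ).trans (lintegral_congr h),
    ← ofReal_integral_eq_lintegral_ofReal (hi.const_mul _)
    (.of_forall fun z => by positivity), integral_const_mul, ENNReal.toReal_ofReal]
  have : 0 ≤ ∫ z in Ioi (0 : ℝ), Real.exp (-(Real.pi * (M * (b - 1) + L) * z +
      T * s / p * z ^ (α / 2))) := integral_nonneg fun z => (Real.exp_pos _).le
  positivity

theorem proposition4 {K : ℕ} {Ω : Type*} [MeasurableSpace Ω] (μ : Measure Ω)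
    [IsProbabilityMeasure μ]
    (S : Finset (Fin (K + 1))) (hS : (0 : Fin (K + 1)) ∉ S)
    (lam w : Fin (K + 1) → ℝ)
    (hlam : ∀ k, 0 ≤ lam k) (hpos : 0 < netIntensity S lam)
    (hw : ∀ k ∈ insert 0 S, 0 ≤ w k) (hw1 : ∑ k ∈ insert 0 S, w k = 1)
    (α p T : ℝ) (hα : 2 < α) (hp : 0 < p) (hT : 0 < T)
    (ν : Measure ℝ) (hν : ∀ᵐ g ∂ν, 0 < g) (hβ : Integrable (betaTerm T p α) ν)
    (N : CellularNetwork K Ω) (hN : N.IsModel μ S lam w p ν) :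
    -- the coverage probability
    (∀ s : ℝ, 0 ≤ s →
      IntegrableOn (fun z : ℝ => Real.exp (-(Real.pi *
          (interfererIntensity S w lam * (betaConst T p α ν - 1) + netIntensity S lam) * z
        + T * s / p * z ^ (α / 2)))) (Ioi 0) ∧
      N.coverageProb μ S p α s T = Real.pi * netIntensity S lam *
        ∫ z in Ioi (0 : ℝ), Real.exp (-(Real.pi *
            (interfererIntensity S w lam * (betaConst T p α ν - 1) + netIntensity S lam) * z
          + T * s / p * z ^ (α / 2)))) ∧
    -- the closed form of the approximation
    (∀ s : ℝ, 0 ≤ s →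
      approxCoverage (netIntensity S lam)
          (Real.pi *
            (interfererIntensity S w lam * (betaConst T p α ν - 1) + netIntensity S lam))
          (T * s / p) α =
        (1 + interfererIntensity S w lam * (betaConst T p α ν - 1) / netIntensity S lam
          + α / (2 * Real.pi * netIntensity S lam) *
            ((T * s / p) ^ (2 / α) / Real.Gamma (2 / α)))⁻¹) ∧
    -- it is asymptotically exact in the interference-limited and in the noise-limited regime
    (∀ l : Filter ℝ, l = 𝓝[>] 0 ∨ l = atTop →
      Asymptotics.IsEquivalent l (fun s => N.coverageProb μ S p α s T)
        (fun s => (1 + interfererIntensity S w lam * (betaConst T p α ν - 1) / netIntensity S lam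
          + α / (2 * Real.pi * netIntensity S lam) *
            ((T * s / p) ^ (2 / α) / Real.Gamma (2 / α)))⁻¹)) ∧
    -- the activity levels, when they are the association probabilities
    (∀ k ∈ insert 0 S, N.associationProb μ S k = lam k / netIntensity S lam) := by
  classical
  have hL : netIntensity S lam = ∑ k ∈ insert 0 S, lam k := by
    rw [netIntensity, Finset.sum_insert hS]
  have hν' := hN.isProbabilityMeasure_gain
  have hβ1 := one_le_betaConst hα hT hp hν hβ
  have hM : 0 ≤ interfererIntensity S w lam :=
    Finset.sum_nonneg fun k hk => mul_nonneg (hw k hk) (hlam k)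
  have hA : 0 < Real.pi *
      (interfererIntensity S w lam * (betaConst T p α ν - 1) + netIntensity S lam) :=
    mul_pos Real.pi_pos (add_pos_of_nonneg_of_pos (mul_nonneg hM (by linarith)) hpos)
  have hcov : ∀ s : ℝ, 0 ≤ s → N.coverageProb μ S p α s T = Real.pi * netIntensity S lam *
      ∫ z in Ioi (0 : ℝ), Real.exp (-(Real.pi *
          (interfererIntensity S w lam * (betaConst T p α ν - 1) + netIntensity S lam) * z
        + T * s / p * z ^ (α / 2))) := fun s hs => by
    rw [hL] at hpos hA ⊢
    exact hN.coverageProb_eq hlam hpos hw hα hp hT hs hν hβ hA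
  have hform : ∀ s : ℝ, approxCoverage (netIntensity S lam)
      (Real.pi * (interfererIntensity S w lam * (betaConst T p α ν - 1) + netIntensity S lam))
      (T * s / p) α =
      (1 + interfererIntensity S w lam * (betaConst T p α ν - 1) / netIntensity S lam
        + α / (2 * Real.pi * netIntensity S lam) *
          ((T * s / p) ^ (2 / α) / Real.Gamma (2 / α)))⁻¹ := fun s => by
    rw [approxCoverage, ← inv_inj, mul_inv, inv_inv, inv_inv]
    field_simp
    ring
  refine ⟨fun s hs => ⟨integrableOn_exp_neg_add_rpow hA (by positivity) α, hcov s hs⟩,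
    fun s _ => hform s, fun l hl => ?_, fun k hk => ?_⟩
  · have hTp : 0 < T / p := by positivity
    -- The asymptotics are known in B = Ts/p; this linear change of variable carries each of the two
    -- regimes in the noise variance to the same regime in B.
    have hB : Tendsto (fun s : ℝ => T * s / p) l l := by
      rcases hl with rfl | rfl
      · refine tendsto_nhdsWithin_iff.2 ⟨?_, ?_⟩
        · have : Continuous fun s : ℝ => T * s / p := by fun_prop
          have h := (this.tendsto 0).mono_left (nhdsWithin_le_nhds (s := Ioi 0))
          simpa using h
        · filter_upwards [self_mem_nhdsWithin] with s hs
          have : 0 < s := hs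
          exact mem_Ioi.2 (by positivity)
      · simpa only [mul_div_right_comm, id] using tendsto_id.const_mul_atTop hTp
    have hs0 : ∀ᶠ s in l, (0 : ℝ) ≤ s := by
      rcases hl with rfl | rfl
      · filter_upwards [self_mem_nhdsWithin] with s hs using le_of_lt hs
      · exact eventually_ge_atTop 0
    have h := (approxCoverage_isEquivalent hpos hA (by linarith : 0 < α) hl).comp_tendsto hB
    refine (h.congr_left ?_).congr_right (.of_forall fun s => hform s)
    filter_upwards [hs0] with s hs using (hcov s hs).symm
  · rw [hL] at hpos ⊢
    exact hN.associationProb_eq hlam hpos k hk
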